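/- Let $\mathbb K$ be a field and let $V$ be a finite-dimensional $\mathbb K$-vector space. A (central, simple) hyperplane arrangement $\mathcal A$ in $V$ is a finite set of linear hyperplanes of $V$. For a subspace $U\subseteq V$ put $\mathcal A_U=\{H\in\mathcal A\mid U\subseteq H\}$, an arrangement in $V$ (the localization at $U$), and $\mathcal A^U=\{U\cap H\mid H\in\mathcal A\setminus\mathcal A_U\}$, an arrangement in $U$ (the restriction to $U$). Let $L(\mathcal A)$ be the set of all intersections of subsets of $\mathcal A$ (with $V$ as the empty intersection). For $H\in\mathcal A$ put $\mathcal A'=\mathcal A\setminus\{H\}$ and $\mathcal A''=\mathcal A^{H}$. Let $S=S(V^*)$. For $H\in\mathcal A$ choose $\alpha_H\in V^*$ with $H=\ker\alpha_H$, and let $D(\mathcal A)$ be the $S$-module of all $\mathbb K$-derivations $\theta$ of $S$ with $\theta(\alpha_H)\in\alpha_H S$ for every $H\in\mathcal A$. A derivation $\theta$ of $S$ is homogeneous of polynomial degree $p$ if $\theta(\alpha)$ is $0$ or homogeneous of degree $p$ for every $\alpha\in V^*$. If the $S$-module $D(\mathcal A)$ is free, it has a basis of $\dim V$ homogeneous derivations,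 and the multiset $\exp\mathcal A$ of their polynomial degrees does not depend on the basis. An inclusion $\exp\mathcal B\subseteq\exp\mathcal C$ below is an inclusion of multisets, and it includes the requirement that $D(\mathcal B)$ and $D(\mathcal C)$ are free. The class of inductively free arrangements is the smallest class of arrangements in finite-dimensional $\mathbb K$-vector spaces such that (i) it contains the empty arrangement in every such space; (ii) if for some $H\in\mathcal A$ both $\mathcal A'$ and $\mathcal A''$ belong to the class and $\exp\mathcal A''\subseteq\exp\mathcal A'$, then $\mathcal A$ belongs to it. The class of recursively free arrangements is the smallest class that satisfies (i), (ii) and (iii): if for some $H\in\mathcal A$ both $\mathcal A$ and $\mathcal A''$ belong to the class and $\exp\mathcal A''\subseteq\exp\mathcal A$, then $\mathcal A'$ belongs to it. The arrangement $\mathcal A$ is hereditarily inductively free if $\mathcal A^X$ is inductively free for every $X\in L(\mathcal A)$. **Theorem.** Let $\mathcal A$ be an arrangement in $V$ and let $U\subseteq V$ be a subspace (for example $U=X\in L(\mathcal A)$). 1. If $\mathcal A$ is inductively free, then so is $\mathcal A_U$. 2. If $\mathcal A$ is recursively free, then so is $\mathcal A_U$. 3. If $\mathcal A$ is hereditarily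 inductively free, then so is $\mathcal A_U$. -/

import Mathlib

universe u v

/-- A central hyperplane arrangement in the `K`-vector space `V`: a finite set of linear hyperplanes
of `V`, a hyperplane being the kernel of a nonzero linear form. -/
structure HyperplaneArrangement (K : Type v) [Field K] (V : Type u) [AddCommGroup V]
    [Module K V] where
  /-- the hyperplanes of the arrangement -/
  carrier : Set (Submodule K V)
  finite_carrier : carrier.Finite
  exists_form : ∀ H ∈ carrier, ∃ α : Module.Dual K V, α ≠ 0 ∧ LinearMap.ker α = H

namespace HyperplaneArrangement

section Basic

variable {K : Type v} [Field K] {V : Type u} [AddCommGroup V] [Module K V]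

/-- The empty arrangement in `V`. -/
def empty (K : Type v) [Field K] (V : Type u) [AddCommGroup V] [Module K V] :
    HyperplaneArrangement K V where
  carrier := ∅
  finite_carrier := Set.finite_empty
  exists_form := fun _ h => absurd h (Set.notMem_empty _)

/-- The deletion `A' = A \ {H}`. -/
def deletion (A : HyperplaneArrangement K V) (H : Submodule K V) : HyperplaneArrangement K V where
  carrier := A.carrier \ {H}
  finite_carrier := A.finite_carrier.subset Set.sdiff_subset
  exists_form := fun H' h => A.exists_form H' h.1

/-- The localization `A_U = {H ∈ A | U ⊆ H}` at a subspace `U` of `V`; it is again an arrangement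
in `V`. -/
def localization (A : HyperplaneArrangement K V) (U : Submodule K V) :
    HyperplaneArrangement K V where
  carrier := {H ∈ A.carrier | U ≤ H}
  finite_carrier := A.finite_carrier.subset (Set.sep_subset _ _)
  exists_form := fun H' h => A.exists_form H' h.1

/-- The restriction `A^U = {U ∩ H | H ∈ A, U ⊄ H}`, an arrangement in the vector space `U`.
The subspace `U ∩ H` of `U` is the preimage of `H` under the inclusion of `U` in `V`.
If `H₀` is a hyperplane of `A`, then `A^H₀` is `A'' = {H ∩ H₀ | H ∈ A \ {H₀}}`. -/
def restriction (A : HyperplaneArrangement K V) (U : Submodule K V) :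
    HyperplaneArrangement K U where
  carrier := (fun H => H.comap U.subtype) '' {H ∈ A.carrier | ¬ U ≤ H}
  finite_carrier := (A.finite_carrier.subset (Set.sep_subset _ _)).image _
  exists_form := by
    rintro _ ⟨H, ⟨hH, hU⟩, rfl⟩
    obtain ⟨α, -, rfl⟩ := A.exists_form H hH
    refine ⟨α.comp U.subtype, fun h0 => hU fun x hx => ?_, LinearMap.ker_comp _ _⟩
    simpa using LinearMap.congr_fun h0 (⟨x, hx⟩ : U)

/-- The intersection lattice `L(A)`: all intersections of subsets of `A`. The intersection of the
empty subset is `V`. -/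
def lattice (A : HyperplaneArrangement K V) : Set (Submodule K V) :=
  {X | ∃ B ⊆ A.carrier, X = sInf B}

end Basic

section Derivations

variable {K : Type v} [Field K] {V : Type u} [AddCommGroup V] [Module K V]

/-- The symmetric algebra `S = S(V*)` of the dual space. -/
abbrev PolyRing (K : Type v) [Field K] (V : Type u) [AddCommGroup V] [Module K V] :
    Type (max u v) :=
  SymmetricAlgebra K (Module.Dual K V)

/-- A linear form on `V`, as an element of `S`. -/
noncomputable abbrev form (α : Module.Dual K V) : PolyRing K V :=
  SymmetricAlgebra.ι K (Module.Dual K V) α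

/-- The homogeneous component `S_p` of degree `p` of `S`: the `K`-span of the products of `p` linear
forms. -/
noncomputable def gradedPiece (K : Type v) [Field K] (V : Type u) [AddCommGroup V] [Module K V]
    (p : ℕ) : Submodule K (PolyRing K V) :=
  LinearMap.range (SymmetricAlgebra.ι K (Module.Dual K V)) ^ p

/-- A derivation `θ` of `S` is homogeneous of polynomial degree `p` if it maps every linear form
into `S_p`; equivalently, in coordinates, `θ = ∑ fᵢ ∂/∂xᵢ` with all `fᵢ = θ(xᵢ)` in `S_p`. -/
def IsHomogeneousOfDegree (θ : Derivation K (PolyRing K V) (PolyRing K V)) (p : ℕ) : Prop :=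
  ∀ α : Module.Dual K V, θ (form α) ∈ gradedPiece K V p

/-- The `S`-module `D(A)` of the derivations `θ` of `S` with `θ(α_H) ∈ α_H S` for each `H` in `A`.
The condition does not depend on the linear form `α_H` with kernel `H`, which is unique up to
a nonzero scalar, so it is imposed on all of them. -/
def derivationModule (A : HyperplaneArrangement K V) :
    Submodule (PolyRing K V) (Derivation K (PolyRing K V) (PolyRing K V)) where
  carrier := {θ | ∀ α : Module.Dual K V, LinearMap.ker α ∈ A.carrier → form α ∣ θ (form α)}
  add_mem' := fun ha hb α hα => by
    rw [Derivation.add_apply]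
    exact dvd_add (ha α hα) (hb α hα)
  zero_mem' := fun α _ => by
    rw [Derivation.zero_apply]
    exact dvd_zero _
  smul_mem' := fun c θ h α hα => by
    rw [Derivation.smul_apply, smul_eq_mul]
    exact Dvd.dvd.mul_left (h α hα) c

/-- `A` is free and `e` is its multiset of exponents: the `S`-module `D(A)` has a basis of
`ℓ = dim V` homogeneous derivations whose polynomial degrees form the multiset `e`. -/
def HasExponents (A : HyperplaneArrangement K V) (e : Multiset ℕ) : Prop :=
  ∃ (θ : Module.Basis (Fin (Module.finrank K V)) (PolyRing K V) A.derivationModule)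
    (d : Fin (Module.finrank K V) → ℕ),
    (∀ i, IsHomogeneousOfDegree (θ i : Derivation K (PolyRing K V) (PolyRing K V)) (d i)) ∧
      e = Finset.univ.val.map d

end Derivations

/-- `exp A ⊆ exp B` as multisets, for free arrangements `A` and `B` (possibly in different vector
spaces). -/
def ExponentsSubset {K : Type v} [Field K] {V W : Type u} [AddCommGroup V] [Module K V]
    [AddCommGroup W] [Module K W] (A : HyperplaneArrangement K V)
    (B : HyperplaneArrangement K W) : Prop :=
  ∃ e f : Multiset ℕ, A.HasExponents e ∧ B.HasExponents f ∧ e ≤ f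

/-- The class of inductively free arrangements: the smallest class of arrangements in
finite-dimensional `K`-vector spaces that contains all empty arrangements and contains `A` as soon
as, for some `H ∈ A`, it contains `A'` and `A''` and `exp A'' ⊆ exp A'`. -/
inductive IsInductivelyFree {K : Type v} [Field K] :
    ∀ {V : Type u} [AddCommGroup V] [Module K V], HyperplaneArrangement K V → Prop
  | empty (V : Type u) [AddCommGroup V] [Module K V] [FiniteDimensional K V] :
      IsInductivelyFree (HyperplaneArrangement.empty K V)
  | addition {V : Type u} [AddCommGroup V] [Module K V] (A : HyperplaneArrangement K V)
      (H : Submodule K V) (hH : H ∈ A.carrier) (h' : IsInductivelyFree (A.deletion H))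
      (h'' : IsInductivelyFree (A.restriction H))
      (hexp : ExponentsSubset (A.restriction H) (A.deletion H)) : IsInductivelyFree A

/-- The class of recursively free arrangements: the smallest class of arrangements in
finite-dimensional `K`-vector spaces that contains all empty arrangements, contains `A` as soon as,
for some `H ∈ A`, it contains `A'` and `A''` and `exp A'' ⊆ exp A'`, and contains `A'` as soon as
(for some `A` and `H ∈ A`) it contains `A` and `A''` and `exp A'' ⊆ exp A`. -/
inductive IsRecursivelyFree {K : Type v} [Field K] :
    ∀ {V : Type u} [AddCommGroup V] [Module K V], HyperplaneArrangement K V → Prop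
  | empty (V : Type u) [AddCommGroup V] [Module K V] [FiniteDimensional K V] :
      IsRecursivelyFree (HyperplaneArrangement.empty K V)
  | addition {V : Type u} [AddCommGroup V] [Module K V] (A : HyperplaneArrangement K V)
      (H : Submodule K V) (hH : H ∈ A.carrier) (h' : IsRecursivelyFree (A.deletion H))
      (h'' : IsRecursivelyFree (A.restriction H))
      (hexp : ExponentsSubset (A.restriction H) (A.deletion H)) : IsRecursivelyFree A
  | deletion {V : Type u} [AddCommGroup V] [Module K V] (A : HyperplaneArrangement K V)
      (H : Submodule K V) (hH : H ∈ A.carrier) (h : IsRecursivelyFree A)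
      (h'' : IsRecursivelyFree (A.restriction H))
      (hexp : ExponentsSubset (A.restriction H) A) : IsRecursivelyFree (A.deletion H)

/-- `A` is hereditarily inductively free if `A^X` is inductively free for each `X ∈ L(A)`. -/
def IsHereditarilyInductivelyFree {K : Type v} [Field K] {V : Type u} [AddCommGroup V]
    [Module K V] (A : HyperplaneArrangement K V) : Prop :=
  ∀ X ∈ A.lattice, (A.restriction X).IsInductivelyFree

end HyperplaneArrangement

set_option linter.unusedSectionVars false

/-! Write A' and A'' for the deletion and the restriction of A at a hyperplane H = ker α, Q for
defining polynomials, and S'' for the polynomial ring of H. If U ⊆ H, localization at U commutes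
with deletion and restriction; if U ⊄ H, then A and A' have the same localization. Induction over
the construction of A therefore reduces the theorem to one claim: the inclusion of exponents
survives localization (`ExponentsSubset.localization`).

The inclusion is not localized directly but replaced by a stronger datum, `HasAdaptedBasis`: dim V
homogeneous derivations, all but one in D(A) and the last in D(A'), whose determinant is a nonzero
scalar times Q(A'). By Saito's criterion they form a basis of D(A'). Multiplying the last one by α
gives a basis of D(A), and restricting the others to H gives a basis of D(A''). Both inclusions of
exponents can be read off.

Either inclusion yields an adapted basis by counting dimensions. The map θ ↦ θ(α)|_H on D(A') has
kernel D(A), and its image lies in B·S'' for an explicit B of degree |A'| − |A''|. Restriction to H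
on D(A) has kernel α·D(A') and image in D(A''). The exponents force the dimensions of the two images
to add up to the sum of these upper bounds, so both images are as large as possible. Lifting a basis
of D(A'') and a derivation with θ(α)|_H ≠ 0 of degree deg B gives the adapted basis.

An adapted basis localizes at a vector u by translating the origin to u. The lowest homogeneous part
of the translated Q(A') is a scalar times the defining polynomial of the localization of A' at u.
Expanding the determinant by rows into homogeneous components, some choice of components has nonzero
determinant of exactly this degree. Each row stays logarithmic for the localization of its own
arrangement, so the result is again adapted. A subspace is reached by treating its generators one at
a time. -/

namespace HyperplaneArrangement

open MvPolynomial

/-! ### Linear forms, logarithmic derivations and Saito's criterion in coordinates -/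

section Coordinates

/-- A homogeneous multiple of minimal degree is a scalar multiple. -/
lemma exists_C_of_dvd_isHomogeneous {K : Type*} [Field K] {I : Type*}
    {f g : MvPolynomial I K} {n : ℕ} (hf : f.IsHomogeneous n) (hg : g.IsHomogeneous n)
    (hg0 : g ≠ 0) (h : f ∣ g) : ∃ c : K, c ≠ 0 ∧ g = C c * f := by
  obtain ⟨k, rfl⟩ := h
  have hf0 := left_ne_zero_of_mul hg0
  have hk0 := right_ne_zero_of_mul hg0
  have hdeg := hg.totalDegree hg0
  rw [totalDegree_mul_of_isDomain hf0 hk0, hf.totalDegree hf0] at hdeg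
  obtain ⟨c, rfl⟩ : ∃ c, k = C c := ⟨_, totalDegree_eq_zero_iff_eq_C.1 (by omega)⟩
  exact ⟨c, by rintro rfl; simp at hk0, mul_comm _ _⟩

variable {K : Type*} [Field K] {I : Type*} [Fintype I]

/-- The pairing of a vector of scalars with a vector of polynomials. -/
noncomputable def pairing (v : I → K) :
    (I → MvPolynomial I K) →ₗ[MvPolynomial I K] MvPolynomial I K :=
  ∑ i, (C (v i) : MvPolynomial I K) • LinearMap.proj i

lemma pairing_apply (v : I → K) (θ : I → MvPolynomial I K) :
    pairing v θ = ∑ i, C (v i) * θ i := by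
  simp [pairing]

/-- The linear form with coefficient vector `v`. -/
noncomputable def linForm (v : I → K) : MvPolynomial I K := pairing v X

lemma linForm_eq (v : I → K) : linForm v = ∑ i, C (v i) * X i := pairing_apply v X

lemma pairing_smul_left (c : K) (v : I → K) (θ : I → MvPolynomial I K) :
    pairing (c • v) θ = C c * pairing v θ := by
  simp [pairing_apply, Finset.mul_sum, mul_assoc]

lemma pairing_sub_left (v w : I → K) (θ : I → MvPolynomial I K) :
    pairing (v - w) θ = pairing v θ - pairing w θ := by
  simp [pairing_apply, sub_mul]

lemma pairing_single [DecidableEq I] (i : I) (c : K) (θ : I → MvPolynomial I K) :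
    pairing (Pi.single i c) θ = C c * θ i := by
  rw [pairing_apply, Finset.sum_eq_single i] <;> simp +contextual

lemma linForm_smul (c : K) (v : I → K) : linForm (c • v) = C c * linForm v :=
  pairing_smul_left c v X

lemma linForm_single [DecidableEq I] (i : I) : linForm (Pi.single i (1 : K)) = X i := by
  simp [linForm, pairing_single]

lemma isHomogeneous_linForm (v : I → K) : (linForm v).IsHomogeneous 1 := by
  rw [linForm_eq]
  exact IsHomogeneous.sum _ _ _ fun i _ => isHomogeneous_C_mul_X _ _

lemma coeff_linForm (v : I → K) (i : I) : (linForm v).coeff (Finsupp.single i 1) = v i := by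
  classical
  rw [linForm_eq, coeff_sum, Finset.sum_eq_single i]
  · simp
  · intro j _ hj
    rw [coeff_C_mul, coeff_X, if_neg, mul_zero]
    rwa [Finsupp.single_left_inj one_ne_zero]
  · simp

lemma linForm_injective : Function.Injective (linForm : (I → K) → MvPolynomial I K) := by
  intro v w h
  funext i
  rw [← coeff_linForm v, h, coeff_linForm]

lemma linForm_ne_zero {v : I → K} (hv : v ≠ 0) : linForm v ≠ 0 := by
  intro h
  refine hv (linForm_injective ?_)
  rw [h, linForm_eq]
  simp

lemma irreducible_linForm {v : I → K} (hv : v ≠ 0) : Irreducible (linForm v) := by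
  refine irreducible_of_totalDegree_eq_one
    ((isHomogeneous_linForm v).totalDegree (linForm_ne_zero hv)) fun x hx => ?_
  obtain ⟨i, hi⟩ := Function.ne_iff.1 hv
  have := hx (Finsupp.single i 1)
  rw [coeff_linForm] at this
  exact (ne_zero_of_dvd_ne_zero hi this).isUnit

lemma prime_linForm {v : I → K} (hv : v ≠ 0) : Prime (linForm v) :=
  (irreducible_linForm hv).prime

lemma exists_smul_of_linForm_dvd {v w : I → K} (hw : w ≠ 0) (h : linForm v ∣ linForm w) :
    ∃ c : K, w = c • v := by
  obtain ⟨g, hg⟩ := h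
  have hne := linForm_ne_zero hw
  have hv : linForm v ≠ 0 := by rintro h0; simp [h0] at hg; exact hne hg
  have hg0 : g ≠ 0 := by rintro rfl; simp at hg; exact hne hg
  have hdeg := congrArg totalDegree hg
  rw [totalDegree_mul_of_isDomain hv hg0, (isHomogeneous_linForm v).totalDegree hv,
    (isHomogeneous_linForm w).totalDegree hne] at hdeg
  obtain ⟨c, rfl⟩ : ∃ c, g = C c := ⟨_, totalDegree_eq_zero_iff_eq_C.1 (by omega)⟩
  exact ⟨c, linForm_injective (by rw [hg, linForm_smul, mul_comm])⟩

variable {X : Type*}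

/-- The coefficient vectors `a x`, `x ∈ T`, are nonzero and pairwise not proportional. -/
structure Reduced (T : Finset X) (a : X → I → K) : Prop where
  ne_zero : ∀ x ∈ T, a x ≠ 0
  eq_of_smul : ∀ x ∈ T, ∀ y ∈ T, ∀ c : K, a x = c • a y → x = y

lemma Reduced.mono {S T : Finset X} {a : X → I → K} (h : Reduced T a) (hST : S ⊆ T) :
    Reduced S a :=
  ⟨fun x hx => h.ne_zero x (hST hx), fun x hx y hy => h.eq_of_smul x (hST hx) y (hST hy)⟩

lemma Reduced.not_dvd {T : Finset X} {a : X → I → K} (h : Reduced T a) {x y : X} (hx : x ∈ T)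
    (hy : y ∈ T) (hxy : x ≠ y) : ¬ linForm (a x) ∣ linForm (a y) := fun hd => by
  obtain ⟨c, hc⟩ := exists_smul_of_linForm_dvd (h.ne_zero y hy) hd
  exact hxy (h.eq_of_smul y hy x hx c hc).symm

lemma Reduced.isRelPrime {T : Finset X} {a : X → I → K} (h : Reduced T a) {x y : X} (hx : x ∈ T)
    (hy : y ∈ T) (hxy : x ≠ y) : IsRelPrime (linForm (a x)) (linForm (a y)) :=
  (irreducible_linForm (h.ne_zero x hx)).isRelPrime_iff_not_dvd.2 (h.not_dvd hx hy hxy)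

/-- The defining polynomial of a family of linear forms. -/
noncomputable def definingPoly (T : Finset X) (a : X → I → K) : MvPolynomial I K :=
  ∏ x ∈ T, linForm (a x)

lemma Reduced.definingPoly_ne_zero {T : Finset X} {a : X → I → K} (h : Reduced T a) :
    definingPoly T a ≠ 0 :=
  Finset.prod_ne_zero_iff.2 fun x hx => linForm_ne_zero (h.ne_zero x hx)

lemma isHomogeneous_definingPoly (T : Finset X) (a : X → I → K) :
    (definingPoly T a).IsHomogeneous T.card := by
  have := IsHomogeneous.prod T (fun x => linForm (a x)) (fun _ => 1)
    fun x _ => isHomogeneous_linForm (a x)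
  simpa [definingPoly] using this

lemma Reduced.definingPoly_dvd {T : Finset X} {a : X → I → K} (h : Reduced T a)
    {f : MvPolynomial I K} (hf : ∀ x ∈ T, linForm (a x) ∣ f) : definingPoly T a ∣ f :=
  Finset.prod_dvd_of_isRelPrime (fun _ hx _ hy hxy => h.isRelPrime hx hy hxy) hf

/-- The module of logarithmic derivations, in coordinates: a derivation is given by its values
on the variables. -/
noncomputable def logDer (T : Finset X) (a : X → I → K) :
    Submodule (MvPolynomial I K) (I → MvPolynomial I K) where
  carrier := {θ | ∀ x ∈ T, linForm (a x) ∣ pairing (a x) θ}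
  add_mem' h h' x hx := by rw [map_add]; exact dvd_add (h x hx) (h' x hx)
  zero_mem' x _ := by rw [map_zero]; exact dvd_zero _
  smul_mem' c θ h x hx := by rw [map_smul, smul_eq_mul]; exact (h x hx).mul_left c

lemma logDer_anti {S T : Finset X} (a : X → I → K) (h : S ⊆ T) : logDer T a ≤ logDer S a :=
  fun _ hθ x hx => hθ x (h hx)

variable [DecidableEq I]

/-- On the hyperplane of `v` the matrix kills the constant vector `v`, so its determinant vanishes
there. Multiplying by the adjugate turns this into a divisibility. -/
lemma linForm_dvd_det {v : I → K} (hv : v ≠ 0) (M : Matrix I I (MvPolynomial I K))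
    (h : ∀ i, linForm v ∣ pairing v (M i)) : linForm v ∣ M.det := by
  obtain ⟨k, hk⟩ := Function.ne_iff.1 hv
  have h1 : M.adjugate.mulVec (M.mulVec fun i => C (v i)) = M.det • fun i => C (v i) := by
    rw [Matrix.mulVec_mulVec, Matrix.adjugate_mul, Matrix.smul_mulVec, Matrix.one_mulVec]
  have h2 := congrFun h1 k
  have h3 : linForm v ∣ M.det * C (v k) := by
    rw [show M.det * C (v k) = (M.det • fun i => (C (v i) : MvPolynomial I K)) k from rfl, ← h2]
    refine Finset.dvd_sum fun i _ => Dvd.dvd.mul_left ?_ _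
    convert h i using 1
    rw [pairing_apply]
    exact Finset.sum_congr rfl fun _ _ => mul_comm _ _
  exact (IsUnit.dvd_mul_right ((isUnit_iff_ne_zero.2 hk).map C)).1 h3

lemma Reduced.definingPoly_dvd_det {T : Finset X} {a : X → I → K} (h : Reduced T a)
    {M : Matrix I I (MvPolynomial I K)} (hM : ∀ i, M i ∈ logDer T a) :
    definingPoly T a ∣ M.det :=
  h.definingPoly_dvd fun x hx => linForm_dvd_det (h.ne_zero x hx) M fun i => hM i x hx

lemma isHomogeneous_det {M : Matrix I I (MvPolynomial I K)} {d : I → ℕ}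
    (hM : ∀ i j, (M i j).IsHomogeneous (d i)) : M.det.IsHomogeneous (∑ i, d i) := by
  -- After transposing, each product in the Leibniz formula runs over the rows, with one factor of
  -- degree `d i` from row `i`.
  rw [← Matrix.det_transpose, Matrix.det_apply]
  refine IsHomogeneous.sum _ _ _ fun σ _ => ?_
  have := IsHomogeneous.prod Finset.univ (fun i => M i (σ i)) d fun i _ => hM i (σ i)
  rcases Int.units_eq_one_or (Equiv.Perm.sign σ) with h | h <;> rw [h]
  · simpa using this
  · simpa using this.neg

/-- Elements of `D` whose determinant is a scalar multiple of the defining polynomial span `D`. -/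
lemma Reduced.exists_eq_sum_of_det {T : Finset X} {a : X → I → K} (h : Reduced T a)
    {M : Matrix I I (MvPolynomial I K)} (hM : ∀ i, M i ∈ logDer T a) {c : K} (hc : c ≠ 0)
    (hdet : M.det = C c * definingPoly T a) {η : I → MvPolynomial I K} (hη : η ∈ logDer T a) :
    ∃ g : I → MvPolynomial I K, η = ∑ i, g i • M i := by
  -- Cramer's rule: the coefficient of `M i` is the determinant with row `i` replaced by `η`,
  -- divided by `M.det`. The numerator is divisible by the defining polynomial, and `M.det` is a
  -- scalar multiple of it.
  have hdvd : ∀ i, definingPoly T a ∣ (M.updateRow i η).det := fun i =>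
    h.definingPoly_dvd_det fun j => by
      by_cases hj : j = i
      · subst hj; simpa using hη
      · simpa [Matrix.updateRow_ne hj] using hM j
  choose q hq using hdvd
  have hcr := Matrix.mulVec_cramer M.transpose η
  refine ⟨fun i => C c⁻¹ * q i, ?_⟩
  have hne : M.det ≠ 0 := by
    rw [hdet]
    exact mul_ne_zero (by simpa using hc) h.definingPoly_ne_zero
  refine smul_right_injective _ hne ?_
  simp only
  rw [Matrix.det_transpose] at hcr
  rw [← hcr]
  funext j
  simp only [Matrix.mulVec, dotProduct, Matrix.transpose_apply, Matrix.cramer_apply,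
    Pi.smul_apply, Finset.sum_apply, smul_eq_mul, Finset.mul_sum]
  refine Finset.sum_congr rfl fun i _ => ?_
  rw [Matrix.updateCol_transpose, Matrix.det_transpose, hq, hdet]
  have : (C c : MvPolynomial I K) * C c⁻¹ = 1 := by rw [← C_mul, mul_inv_cancel₀ hc, C_1]
  linear_combination (-(M i j * definingPoly T a * q i)) * this

/-- Saito's criterion for homogeneous derivations. -/
lemma Reduced.exists_eq_sum_of_isHomogeneous {T : Finset X} {a : X → I → K} (h : Reduced T a)
    {M : Matrix I I (MvPolynomial I K)} (hM : ∀ i, M i ∈ logDer T a) {d : I → ℕ}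
    (hd : ∀ i j, (M i j).IsHomogeneous (d i)) (hdet : M.det ≠ 0) (hsum : ∑ i, d i = T.card)
    {η : I → MvPolynomial I K} (hη : η ∈ logDer T a) :
    ∃ g : I → MvPolynomial I K, η = ∑ i, g i • M i := by
  obtain ⟨c, hc, hcd⟩ := exists_C_of_dvd_isHomogeneous (isHomogeneous_definingPoly T a)
    (hsum ▸ isHomogeneous_det hd) hdet (h.definingPoly_dvd_det hM)
  exact h.exists_eq_sum_of_det hM hc hcd hη

end Coordinates

/-! ### The determinant of a basis: converse of Saito's criterion -/

section Coordinates

variable {K : Type*} [Field K] {I : Type*} [Fintype I] [DecidableEq I] {X : Type*}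

lemma exists_eq_matrix_mul {D : Submodule (MvPolynomial I K) (I → MvPolynomial I K)}
    {M : Matrix I I (MvPolynomial I K)}
    (hspan : ∀ η ∈ D, ∃ g : I → MvPolynomial I K, η = ∑ i, g i • M i)
    {P : Matrix I I (MvPolynomial I K)} (hP : ∀ i, P i ∈ D) :
    ∃ N : Matrix I I (MvPolynomial I K), P = N * M := by
  choose g hg using fun i => hspan (P i) (hP i)
  refine ⟨Matrix.of g, ?_⟩
  ext1 i j
  refine (congrFun (hg i) j).trans ?_
  simp [Matrix.mul_apply]

lemma det_diagonal_mul_one_add_single {R : Type*} [CommRing R] (δ w : I → R) (k : I)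
    (hw : w k = 0) :
    (Matrix.diagonal δ * (1 + Matrix.replicateCol Unit w *
      Matrix.replicateRow Unit (Pi.single k (1 : R)))).det = ∏ i, δ i := by
  rw [Matrix.det_mul, Matrix.det_diagonal, Matrix.det_one_add_replicateCol_mul_replicateRow]
  simp [hw]

/-- Near a given hyperplane there are derivations whose determinant vanishes there to first
order only. -/
lemma Reduced.exists_det_eq_mul_pow [DecidableEq X] {T : Finset X} {a : X → I → K}
    (h : Reduced T a) {y : X} (hy : y ∈ T) :
    ∃ P : Matrix I I (MvPolynomial I K), (∀ i, P i ∈ logDer T a) ∧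
      ∃ n : ℕ, P.det = definingPoly T a * definingPoly (T.erase y) a ^ n := by
  obtain ⟨k, hk⟩ := Function.ne_iff.1 (h.ne_zero y hy)
  have hk : a y k ≠ 0 := hk
  have hQ : linForm (a y) * definingPoly (T.erase y) a = definingPoly T a :=
    Finset.mul_prod_erase T (fun x => linForm (a x)) hy
  have hdvd : ∀ x ∈ T, x ≠ y → linForm (a x) ∣ definingPoly (T.erase y) a := fun x hx hxy =>
    Finset.dvd_prod_of_mem (fun x => linForm (a x)) (Finset.mem_erase.2 ⟨hxy, hx⟩)
  -- Row `k` is Q·e_k. Row `i ≠ k` is (Q / α_y)·(e_i − (a y i / a y k) e_k), whose vector factor is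
  -- annihilated by the form of `y`; the other forms divide Q / α_y.
  let δ : I → MvPolynomial I K := fun i =>
    if i = k then definingPoly T a else definingPoly (T.erase y) a
  let w : I → MvPolynomial I K := fun i => if i = k then 0 else C (-(a y i / a y k))
  refine ⟨Matrix.diagonal δ * (1 + Matrix.replicateCol Unit w *
      Matrix.replicateRow Unit (Pi.single k (1 : MvPolynomial I K))), fun i x hx => ?_,
    Fintype.card I - 1, ?_⟩
  · have hrow : (Matrix.diagonal δ * (1 + Matrix.replicateCol Unit w *
        Matrix.replicateRow Unit (Pi.single k (1 : MvPolynomial I K))) : Matrix I I _) i =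
        δ i • ((Pi.single i 1 : I → MvPolynomial I K) + w i • Pi.single k 1) := by
      funext j
      rw [Matrix.diagonal_mul]
      simp [Matrix.mul_apply, Matrix.one_apply, Pi.single_apply, eq_comm]
    have hsingle : ∀ j, pairing (a x) (Pi.single j 1) = C (a x j) := fun j => by
      rw [pairing_apply, Finset.sum_eq_single j] <;> simp +contextual
    rw [hrow, map_smul, map_add, map_smul, hsingle, hsingle, smul_eq_mul, smul_eq_mul]
    by_cases hik : i = k
    · refine Dvd.dvd.mul_right ?_ _
      simp only [δ, if_pos hik]
      exact Finset.dvd_prod_of_mem (fun x => linForm (a x)) hx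
    · by_cases hxy : x = y
      · subst hxy
        simp only [w, if_neg hik]
        rw [← C_mul, ← C_add, neg_mul, div_mul_cancel₀ _ hk, add_neg_cancel, C_0, mul_zero]
        exact dvd_zero _
      · simp only [δ, if_neg hik]
        exact (hdvd x hx hxy).mul_right _
  · rw [det_diagonal_mul_one_add_single _ _ _ (by simp [w]),
      ← Finset.mul_prod_erase Finset.univ δ (Finset.mem_univ k)]
    congr 1
    · simp [δ]
    · rw [Finset.prod_congr rfl fun i hi => if_neg (Finset.ne_of_mem_erase hi)]
      simp [Finset.card_erase_of_mem]

/-- Write the determinant as Q·g. Since Q times each coordinate derivation is logarithmic, the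
determinant divides a power of Q, so an irreducible factor of g is one of the forms α_y. But there
are logarithmic derivations whose determinant is Q times a power of Q / α_y; hence g divides that
power, and α_y would divide another form. So g is a unit. -/
lemma Reduced.exists_det_of_span {T : Finset X} {a : X → I → K} (h : Reduced T a)
    {M : Matrix I I (MvPolynomial I K)} (hM : ∀ i, M i ∈ logDer T a)
    (hspan : ∀ η ∈ logDer T a, ∃ g : I → MvPolynomial I K, η = ∑ i, g i • M i) :
    ∃ c : K, c ≠ 0 ∧ M.det = C c * definingPoly T a := by
  classical
  have hQ0 := h.definingPoly_ne_zero
  obtain ⟨N, hN⟩ := exists_eq_matrix_mul hspan (P := definingPoly T a • 1) fun i x hx => by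
    change linForm (a x) ∣ pairing (a x) (definingPoly T a • (1 : Matrix I I _) i)
    rw [map_smul]
    exact (Finset.dvd_prod_of_mem (fun x => linForm (a x)) hx).mul_right _
  have hN := congrArg Matrix.det hN
  rw [Matrix.det_smul, Matrix.det_one, mul_one, Matrix.det_mul] at hN
  obtain ⟨g, hg⟩ := h.definingPoly_dvd_det hM
  suffices hu : IsUnit g by
    obtain ⟨c, hc, rfl⟩ := MvPolynomial.isUnit_iff_eq_C_of_isReduced.1 hu
    exact ⟨c, hc.ne_zero, by rw [hg, mul_comm]⟩
  by_contra hu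
  have hg0 : g ≠ 0 := by
    rintro rfl
    rw [hg, mul_zero, mul_zero] at hN
    exact pow_ne_zero _ hQ0 hN
  obtain ⟨p, hp, hpg⟩ := WfDvdMonoid.exists_irreducible_factor hu hg0
  have hpQ : p ∣ definingPoly T a := by
    refine hp.prime.dvd_of_dvd_pow (n := Fintype.card I) ?_
    rw [hN, hg]
    exact (hpg.mul_left _).mul_left _
  obtain ⟨y, hy, hpy⟩ := (hp.prime.dvd_finsetProd_iff _).1 hpQ
  have hyp := (hp.associated_of_dvd (irreducible_linForm (h.ne_zero y hy)) hpy).symm.dvd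
  obtain ⟨P, hP, n, hPn⟩ := h.exists_det_eq_mul_pow hy
  obtain ⟨N', hN'⟩ := exists_eq_matrix_mul hspan hP
  rw [hN', Matrix.det_mul, hg] at hPn
  have hgp : g ∣ definingPoly (T.erase y) a ^ n := by
    refine ⟨N'.det, mul_left_cancel₀ hQ0 ?_⟩
    rw [← hPn]
    ring
  obtain ⟨z, hz, hpz⟩ := (hp.prime.dvd_finsetProd_iff _).1
    (hp.prime.dvd_of_dvd_pow (hpg.trans hgp))
  rw [Finset.mem_erase] at hz
  exact h.not_dvd hy hz.2 hz.1.symm (hyp.trans hpz)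

lemma Reduced.sum_degree_of_span {T : Finset X} {a : X → I → K} (h : Reduced T a)
    {M : Matrix I I (MvPolynomial I K)} (hM : ∀ i, M i ∈ logDer T a)
    (hspan : ∀ η ∈ logDer T a, ∃ g : I → MvPolynomial I K, η = ∑ i, g i • M i) {d : I → ℕ}
    (hd : ∀ i j, (M i j).IsHomogeneous (d i)) : ∑ i, d i = T.card := by
  obtain ⟨c, hc, hdet⟩ := h.exists_det_of_span hM hspan
  refine (isHomogeneous_det hd).inj_right (hdet ▸ (isHomogeneous_definingPoly T a).C_mul c) ?_
  rw [hdet]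
  exact mul_ne_zero (by simpa using hc) h.definingPoly_ne_zero

lemma sum_smul_injective_of_det_ne_zero {M : Matrix I I (MvPolynomial I K)} (hdet : M.det ≠ 0)
    {g : I → MvPolynomial I K} (hg : ∑ i, g i • M i = 0) : g = 0 := by
  refine Matrix.eq_zero_of_vecMul_eq_zero hdet ?_
  rw [← hg]
  funext j
  simp [Matrix.vecMul, dotProduct]

end Coordinates

/-! ### Homogeneous components of derivations and determinants -/

section Components

variable {K : Type*} [Field K] {I : Type*}

lemma homogeneousComponent_mul_of_isHomogeneous {f : MvPolynomial I K} {m : ℕ}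
    (hf : f.IsHomogeneous m) (g : MvPolynomial I K) (n : ℕ) :
    homogeneousComponent n (f * g) =
      if m ≤ n then f * homogeneousComponent (n - m) g else 0 := by
  have h1 : homogeneousComponent n (f * g) =
      ∑ i ∈ Finset.range (g.totalDegree + 1),
        if n = m + i then f * homogeneousComponent i g else 0 := by
    conv_lhs => rw [← sum_homogeneousComponent g]
    rw [Finset.mul_sum, map_sum]
    exact Finset.sum_congr rfl fun i _ =>
      homogeneousComponent_of_mem (hf.mul (homogeneousComponent_isHomogeneous i g))
  rw [h1]
  split_ifs with hmn
  · rw [Finset.sum_congr rfl fun i _ => if_congr (show n = m + i ↔ i = n - m by omega) rfl rfl,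
      Finset.sum_ite_eq']
    split_ifs with hi
    · rfl
    · rw [homogeneousComponent_eq_zero _ _ (by rw [Finset.mem_range] at hi; omega), mul_zero]
  · exact Finset.sum_eq_zero fun i _ => if_neg (by omega)

lemma dvd_homogeneousComponent {f g : MvPolynomial I K} {m : ℕ} (hf : f.IsHomogeneous m)
    (h : f ∣ g) (n : ℕ) : f ∣ homogeneousComponent n g := by
  obtain ⟨k, rfl⟩ := h
  rw [homogeneousComponent_mul_of_isHomogeneous hf]
  split_ifs
  · exact dvd_mul_right _ _
  · exact dvd_zero _

variable [Fintype I]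

lemma pairing_homogeneousComponent (v : I → K) (θ : I → MvPolynomial I K) (n : ℕ) :
    pairing v (fun i => homogeneousComponent n (θ i)) = homogeneousComponent n (pairing v θ) := by
  simp [pairing_apply]

variable {X : Type*}

lemma homogeneousComponent_mem_logDer {T : Finset X} {a : X → I → K} {θ : I → MvPolynomial I K}
    (hθ : θ ∈ logDer T a) (n : ℕ) : (fun i => homogeneousComponent n (θ i)) ∈ logDer T a :=
  fun x hx => by
    rw [pairing_homogeneousComponent]
    exact dvd_homogeneousComponent (isHomogeneous_linForm _) (hθ x hx) n

variable [DecidableEq I]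

/-- The determinant is multilinear in the rows: it is the sum, over all choices of one degree per
row, of determinants that are homogeneous of the total chosen degree. A nonzero component of degree
`n` needs a nonzero summand of that degree. -/
lemma exists_det_homogeneousComponent_ne_zero {M : I → I → MvPolynomial I K} {n : ℕ}
    (h : homogeneousComponent n (Matrix.of M).det ≠ 0) :
    ∃ d : I → ℕ, ∑ i, d i = n ∧
      (Matrix.of fun i j => homogeneousComponent (d i) (M i j)).det ≠ 0 := by
  -- A common bound above the degrees of all entries, so that every row is decomposed over the same
  -- finite range.
  let N := (Finset.univ.sup fun p : I × I => (M p.1 p.2).totalDegree) + 1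
  have hM : M = fun i => ∑ k ∈ Finset.range N, fun j => homogeneousComponent k (M i j) := by
    funext i j
    rw [Finset.sum_apply]
    conv_lhs => rw [← sum_homogeneousComponent (M i j)]
    refine Finset.sum_subset (Finset.range_subset_range.2 (Nat.succ_le_succ
      (Finset.le_sup (f := fun p : I × I => (M p.1 p.2).totalDegree)
        (Finset.mem_univ (i, j))))) fun k _ hk => ?_
    exact homogeneousComponent_eq_zero _ _ (by simpa [Nat.lt_succ_iff] using hk)
  have hdet : (Matrix.of M).det = ∑ d ∈ Fintype.piFinset fun _ : I => Finset.range N,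
      (Matrix.of fun i j => homogeneousComponent (d i) (M i j)).det := by
    conv_lhs => rw [hM]
    exact (Matrix.detRowAlternating (R := MvPolynomial I K)
      (n := I)).toMultilinearMap.map_sum_finset
      (fun i k => fun j => homogeneousComponent k (M i j)) fun _ => Finset.range N
  rw [hdet, map_sum] at h
  obtain ⟨d, -, hd⟩ := Finset.exists_ne_zero_of_sum_ne_zero h
  have hhom : (Matrix.of fun i j => homogeneousComponent (d i) (M i j)).det.IsHomogeneous
      (∑ i, d i) := isHomogeneous_det fun i j => homogeneousComponent_isHomogeneous _ _
  rw [homogeneousComponent_of_mem hhom] at hd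
  split_ifs at hd with hn
  · exact ⟨d, hn.symm, hd⟩
  · exact absurd rfl hd

end Components

/-! ### Localization at a vector by translation -/

section Localization

variable {K : Type*} [Field K] {I : Type*}

/-- The translation `f(x) ↦ f(x + u)`. -/
noncomputable def translate (u : I → K) : MvPolynomial I K →ₐ[K] MvPolynomial I K :=
  aeval fun i => X i + C (u i)

variable [Fintype I]

lemma translate_linForm (u v : I → K) : translate u (linForm v) = linForm v + C (v ⬝ᵥ u) := by
  simp [translate, linForm_eq, mul_add, Finset.sum_add_distrib, dotProduct, algebraMap_eq]

lemma translate_pairing (u v : I → K) (θ : I → MvPolynomial I K) :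
    translate u (pairing v θ) = pairing v fun i => translate u (θ i) := by
  simp [pairing_apply, translate, algebraMap_eq]

variable {X : Type*} [DecidableEq K]

/-- A form that vanishes at `u` is unchanged by translation, so its divisibility condition is
carried over. -/
lemma translate_mem_logDer {T : Finset X} {a : X → I → K} {θ : I → MvPolynomial I K}
    (hθ : θ ∈ logDer T a) (u : I → K) :
    (fun i => translate u (θ i)) ∈ logDer {x ∈ T | a x ⬝ᵥ u = 0} a := fun x hx => by
  rw [Finset.mem_filter] at hx
  have := map_dvd (translate u) (hθ x hx.1)
  rwa [translate_linForm, hx.2, C_0, add_zero, translate_pairing] at this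

/-- The forms vanishing at `u` are fixed and contribute the defining polynomial of the localization.
Each other form acquires a nonzero constant term; the product of these constants is the scalar. -/
lemma homogeneousComponent_translate_definingPoly (T : Finset X) (a : X → I → K) (u : I → K) :
    ∃ c : K, c ≠ 0 ∧
      homogeneousComponent ({x ∈ T | a x ⬝ᵥ u = 0} : Finset X).card
        (translate u (definingPoly T a)) =
      C c * definingPoly {x ∈ T | a x ⬝ᵥ u = 0} a := by
  refine ⟨∏ x ∈ T with ¬ a x ⬝ᵥ u = 0, a x ⬝ᵥ u,
    Finset.prod_ne_zero_iff.2 fun x hx => (Finset.mem_filter.1 hx).2, ?_⟩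
  have h1 : translate u (definingPoly T a) = definingPoly {x ∈ T | a x ⬝ᵥ u = 0} a *
      ∏ x ∈ T with ¬ a x ⬝ᵥ u = 0, (linForm (a x) + C (a x ⬝ᵥ u)) := by
    rw [definingPoly, ← Finset.prod_filter_mul_prod_filter_not T fun x => a x ⬝ᵥ u = 0,
      map_mul, map_prod, map_prod]
    congr 1
    · refine Finset.prod_congr rfl fun x hx => ?_
      rw [translate_linForm, (Finset.mem_filter.1 hx).2, C_0, add_zero]
    · exact Finset.prod_congr rfl fun x _ => translate_linForm _ _
  have h2 : ∀ v : I → K, constantCoeff (linForm v) = 0 := fun v => by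
    simp [linForm_eq]
  rw [h1, homogeneousComponent_mul_of_isHomogeneous (isHomogeneous_definingPoly _ a),
    if_pos le_rfl, Nat.sub_self, homogeneousComponent_zero, mul_comm]
  congr 2
  change constantCoeff _ = _
  simp [h2]

/-- Given derivations, each logarithmic for its own arrangement, with determinant a multiple of
a defining polynomial, there are homogeneous derivations with the same property for the
localizations at a vector `u`. -/
lemma exists_localized_derivations [DecidableEq I] {S : I → Finset X} {T : Finset X}
    {a : X → I → K} (hT : Reduced T a) {M : I → I → MvPolynomial I K}
    (hM : ∀ i, M i ∈ logDer (S i) a) {c : K} (hc : c ≠ 0)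
    (hdet : (Matrix.of M).det = C c * definingPoly T a) (u : I → K) :
    ∃ (M' : I → I → MvPolynomial I K) (d : I → ℕ),
      (∀ i, M' i ∈ logDer {x ∈ S i | a x ⬝ᵥ u = 0} a) ∧
      (∀ i j, (M' i j).IsHomogeneous (d i)) ∧ (Matrix.of M').det ≠ 0 ∧
      ∑ i, d i = ({x ∈ T | a x ⬝ᵥ u = 0} : Finset X).card := by
  obtain ⟨c', hc', hQ⟩ := homogeneousComponent_translate_definingPoly T a u
  have hne : homogeneousComponent ({x ∈ T | a x ⬝ᵥ u = 0} : Finset X).card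
      (Matrix.of fun i j => translate u (M i j)).det ≠ 0 := by
    have h1 : (Matrix.of fun i j => translate u (M i j)).det = translate u (Matrix.of M).det := by
      rw [AlgHom.map_det]
      rfl
    have h2 : translate u (C c) = C c := by
      simp [translate, algebraMap_eq]
    rw [h1, hdet, map_mul, h2, homogeneousComponent_C_mul, hQ]
    exact mul_ne_zero (by simpa using hc) (mul_ne_zero (by simpa using hc')
      (hT.mono (Finset.filter_subset _ _)).definingPoly_ne_zero)
  obtain ⟨d, hsum, hd⟩ := exists_det_homogeneousComponent_ne_zero hne
  exact ⟨fun i j => homogeneousComponent (d i) (translate u (M i j)), d,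
    fun i => homogeneousComponent_mem_logDer (translate_mem_logDer (hM i) u) (d i),
    fun i j => homogeneousComponent_isHomogeneous _ _, hd, hsum⟩

end Localization

/-! ### Restriction of polynomials to a coordinate hyperplane -/

section RestrictPoly

variable {K : Type*} [Field K] {J : Type*}

/-- Restriction of polynomials to the hyperplane where the variable `none` vanishes. -/
noncomputable def restrictPoly : MvPolynomial (Option J) K →ₐ[K] MvPolynomial J K :=
  aeval fun o => o.elim 0 X

@[simp] lemma restrictPoly_X_none : restrictPoly (X none : MvPolynomial (Option J) K) = 0 := by
  simp [restrictPoly]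

@[simp] lemma restrictPoly_X_some (j : J) :
    restrictPoly (X (some j) : MvPolynomial (Option J) K) = X j := by
  simp [restrictPoly]

@[simp] lemma restrictPoly_C (c : K) :
    restrictPoly (C c : MvPolynomial (Option J) K) = C c := by
  simp [restrictPoly, algebraMap_eq]

@[simp] lemma restrictPoly_rename (f : MvPolynomial J K) :
    restrictPoly (rename some f) = f := by
  rw [restrictPoly, aeval_rename]
  exact aeval_X_left_apply f

lemma X_none_dvd_sub (f : MvPolynomial (Option J) K) :
    X none ∣ f - rename some (restrictPoly f) := by
  induction f using MvPolynomial.induction_on with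
  | C c => simp
  | add p q hp hq =>
    rw [map_add, map_add, add_sub_add_comm]
    exact dvd_add hp hq
  | mul_X p o hp =>
    cases o with
    | none => simp
    | some j =>
      rw [map_mul, map_mul, restrictPoly_X_some, rename_X, ← sub_mul]
      exact hp.mul_right _

lemma restrictPoly_eq_zero_iff {f : MvPolynomial (Option J) K} :
    restrictPoly f = 0 ↔ X none ∣ f := by
  refine ⟨fun h => ?_, ?_⟩
  · simpa [h] using X_none_dvd_sub f
  · rintro ⟨g, rfl⟩
    simp

lemma isHomogeneous_restrictPoly {f : MvPolynomial (Option J) K} {n : ℕ}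
    (hf : f.IsHomogeneous n) : (restrictPoly f).IsHomogeneous n := by
  have := hf.aeval (fun o : Option J => (o.elim 0 X : MvPolynomial J K)) (n := 1) fun o => by
    cases o with
    | none => exact isHomogeneous_zero _ _ _
    | some j => exact isHomogeneous_X _ _
  rw [one_mul] at this
  exact this

variable [Fintype J]

lemma pairing_option (v : Option J → K) (θ : Option J → MvPolynomial (Option J) K) :
    pairing v θ = C (v none) * θ none + ∑ j, C (v (some j)) * θ (some j) := by
  rw [pairing_apply, Fintype.sum_option]

lemma restrictPoly_pairing {v : Option J → K} {θ : Option J → MvPolynomial (Option J) K}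
    (hθ : restrictPoly (θ none) = 0) :
    restrictPoly (pairing v θ) =
      pairing (fun j => v (some j)) fun j => restrictPoly (θ (some j)) := by
  rw [pairing_option, pairing_apply]
  simp [hθ]

lemma restrictPoly_linForm (v : Option J → K) :
    restrictPoly (linForm v) = linForm fun j => v (some j) := by
  rw [linForm, restrictPoly_pairing (by simp)]
  simp [linForm]

end RestrictPoly

/-! ### The divisor B of the values θ(α) on the hyperplane -/

section Restriction

variable {K : Type*} [Field K] {J : Type*} [Fintype J] {X Y : Type*} [DecidableEq Y]

/-- The family `a''` of linear forms, indexed by `T''`, is the restriction of the family `a`,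
indexed by `T'`, to the hyperplane where the coordinate `none` vanishes. -/
structure RestrictsTo (T' : Finset X) (a : X → Option J → K) (T'' : Finset Y) (a'' : Y → J → K)
    (π : X → Y) : Prop where
  image_eq : T'.image π = T''
  exists_smul : ∀ x ∈ T', ∃ c : K, c ≠ 0 ∧ (fun j => a x (some j)) = c • a'' (π x)

variable {T' : Finset X} {a : X → Option J → K} {T'' : Finset Y} {a'' : Y → J → K} {π : X → Y}

/-- Hyperplanes with the same trace `y` on the hyperplane have forms whose suitable combinations are
multiples of the coordinate `none`. Comparing the conditions for a fixed member `x₁` of the fibre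
and for another one controls `θ none`; each member other than `x₁` contributes one factor, hence the
exponent: fibre size minus one. -/
lemma RestrictsTo.pow_dvd (hR : RestrictsTo T' a T'' a'' π) (hT' : Reduced T' a) {y : Y}
    {θ : Option J → MvPolynomial (Option J) K} (hθ : θ ∈ logDer T' a) :
    linForm (a'' y) ^ (({x ∈ T' | π x = y} : Finset X).card - 1) ∣ restrictPoly (θ none) := by
  classical
  rcases ({x ∈ T' | π x = y} : Finset X).eq_empty_or_nonempty with h0 | ⟨x₁, hx₁⟩
  · simp [h0]
  set F : Finset X := {x ∈ T' | π x = y} with hF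
  have hmem : ∀ x ∈ F, x ∈ T' := fun x hx => (Finset.mem_filter.1 hx).1
  have hc : ∀ x ∈ F, ∃ c : K, c ≠ 0 ∧ (fun j => a x (some j)) = c • a'' y := fun x hx => by
    rw [← (Finset.mem_filter.1 hx).2]
    exact hR.exists_smul x (hmem x hx)
  obtain ⟨c₁, hc₁, hac₁⟩ := hc x₁ hx₁
  obtain ⟨k, hk⟩ := hθ x₁ (hmem x₁ hx₁)
  -- Here `k` is the quotient of the value of `θ` on the form of `x₁` by that form. The correction
  -- term disappears on the hyperplane.
  have hdvd : ∀ x ∈ F.erase x₁, linForm (a x) ∣ θ none - MvPolynomial.X none * k := by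
    intro x hx
    rw [Finset.mem_erase] at hx
    obtain ⟨c, hc0, hac⟩ := hc x hx.2
    obtain ⟨l, hl⟩ := hθ x (hmem x hx.2)
    set δ := c₁ * a x none - c * a x₁ none with hδ
    have hsub : c₁ • a x - c • a x₁ = Pi.single none δ := by
      funext o
      cases o with
      | none => simp [hδ]
      | some j =>
        have h1 := congrFun hac j
        have h2 := congrFun hac₁ j
        simp only [Pi.smul_apply, smul_eq_mul] at h1 h2
        simp only [Pi.sub_apply, Pi.smul_apply, smul_eq_mul, h1, h2]
        simp
        ring
    -- Otherwise the forms of `x` and `x₁` would be proportional.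
    have hδ0 : δ ≠ 0 := by
      intro h0
      rw [h0, Pi.single_zero, sub_eq_zero] at hsub
      refine hx.1 (hT'.eq_of_smul x (hmem x hx.2) x₁ (hmem x₁ hx₁) (c₁⁻¹ * c) ?_)
      rw [mul_smul, ← hsub, smul_smul, inv_mul_cancel₀ hc₁, one_smul]
    have e1 := congrArg (fun v => pairing v θ) hsub
    have e2 := congrArg linForm hsub
    simp only [linForm, pairing_sub_left, pairing_smul_left, pairing_single] at e1 e2
    have e3 : C δ * (θ none - MvPolynomial.X none * k) = linForm (a x) * (C c₁ * (l - k)) := by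
      rw [hl, hk] at e1
      simp only [linForm] at e1 ⊢
      linear_combination k * e2 - e1
    exact (IsUnit.dvd_mul_left ((isUnit_iff_ne_zero.2 hδ0).map C)).1 (Dvd.intro _ e3.symm)
  have hprod := ((hT'.mono fun x hx => hmem x (Finset.mem_of_mem_erase hx)).definingPoly_dvd hdvd)
  have hprod := map_dvd restrictPoly hprod
  rw [map_sub, map_mul, restrictPoly_X_none, zero_mul, sub_zero] at hprod
  refine Dvd.dvd.trans ?_ hprod
  rw [definingPoly, map_prod, ← Finset.card_erase_of_mem hx₁, ← Finset.prod_const]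
  refine Finset.prod_dvd_prod_of_dvd _ _ fun x hx => ?_
  obtain ⟨c, hc0, hac⟩ := hc x (Finset.mem_of_mem_erase hx)
  rw [restrictPoly_linForm, hac, linForm_smul]
  exact Dvd.intro_left _ rfl

/-- The polynomial which divides, on the hyperplane, the values of the derivations of the deletion
on the form of the hyperplane. -/
lemma RestrictsTo.exists_dvd (hR : RestrictsTo T' a T'' a'' π) (hT' : Reduced T' a)
    (hT'' : Reduced T'' a'') :
    ∃ (B : MvPolynomial J K) (β : ℕ), B ≠ 0 ∧ T''.card + β = T'.card ∧ B.IsHomogeneous β ∧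
      ∀ θ ∈ logDer T' a, B ∣ restrictPoly (θ none) := by
  have hcard : ∀ y ∈ T'', 1 ≤ ({x ∈ T' | π x = y} : Finset X).card := fun y hy => by
    rw [← hR.image_eq, Finset.mem_image] at hy
    obtain ⟨x, hx, hxy⟩ := hy
    exact Finset.card_pos.2 ⟨x, Finset.mem_filter.2 ⟨hx, hxy⟩⟩
  refine ⟨∏ y ∈ T'', linForm (a'' y) ^ (({x ∈ T' | π x = y} : Finset X).card - 1),
    ∑ y ∈ T'', (({x ∈ T' | π x = y} : Finset X).card - 1),
    Finset.prod_ne_zero_iff.2 fun y hy => pow_ne_zero _ (linForm_ne_zero (hT''.ne_zero y hy)),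
    ?_, ?_, fun θ hθ => ?_⟩
  · rw [Finset.card_eq_sum_card_image π T', hR.image_eq, Finset.card_eq_sum_ones,
      ← Finset.sum_add_distrib]
    exact Finset.sum_congr rfl fun y hy => by have := hcard y hy; omega
  · exact IsHomogeneous.prod _ _ _ fun y _ => by simpa using (isHomogeneous_linForm (a'' y)).pow _
  · refine Finset.prod_dvd_of_isRelPrime (fun y hy z hz hyz => ?_) fun y _ => hR.pow_dvd hT' hθ
    exact (hT''.isRelPrime hy hz hyz).pow

end Restriction

/-! ### Homogeneous bases of the module of logarithmic derivations -/

section HomogeneousBasis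

variable {K : Type*} [Field K] {I : Type*} [Fintype I] {X : Type*}

/-- The derivations `θ i` are homogeneous of degrees `d i`, belong to the module of logarithmic
derivations and generate it. -/
structure IsHomogeneousBasis (T : Finset X) (a : X → I → K) (θ : I → I → MvPolynomial I K)
    (d : I → ℕ) : Prop where
  mem : ∀ i, θ i ∈ logDer T a
  isHomogeneous : ∀ i j, (θ i j).IsHomogeneous (d i)
  span : ∀ η ∈ logDer T a, ∃ g : I → MvPolynomial I K, η = ∑ i, g i • θ i

variable {T : Finset X} {a : X → I → K} {θ : I → I → MvPolynomial I K} {d : I → ℕ}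

lemma IsHomogeneousBasis.det_ne_zero [DecidableEq I] (h : IsHomogeneousBasis T a θ d)
    (hT : Reduced T a) : (Matrix.of θ).det ≠ 0 := by
  obtain ⟨c, hc, hdet⟩ := hT.exists_det_of_span (M := Matrix.of θ) h.mem h.span
  rw [hdet]
  exact mul_ne_zero (by simpa using hc) hT.definingPoly_ne_zero

lemma IsHomogeneousBasis.sum_eq_card (h : IsHomogeneousBasis T a θ d) (hT : Reduced T a) :
    ∑ i, d i = T.card := by
  classical
  exact hT.sum_degree_of_span (M := Matrix.of θ) h.mem h.span h.isHomogeneous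

lemma Reduced.isHomogeneousBasis [DecidableEq I] (hT : Reduced T a) (hmem : ∀ i, θ i ∈ logDer T a)
    (hd : ∀ i j, (θ i j).IsHomogeneous (d i)) (hdet : (Matrix.of θ).det ≠ 0)
    (hsum : ∑ i, d i = T.card) : IsHomogeneousBasis T a θ d :=
  ⟨hmem, hd, fun _ hη => hT.exists_eq_sum_of_isHomogeneous (M := Matrix.of θ) hmem hd hdet hsum hη⟩

end HomogeneousBasis

/-! ### Adapted bases: consequences and localization -/

section Triple

variable {K : Type*} [Field K] {J : Type*} [Fintype J] [DecidableEq J] {X Y : Type*}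

lemma det_option_of_col_eq_zero {R : Type*} [CommRing R]
    (N : Matrix (Option J) (Option J) R) (hN : ∀ j, N (some j) none = 0) :
    N.det = N none none * (N.submatrix some some).det := by
  let e := Equiv.optionEquivSumPUnit.{0} J
  rw [← Matrix.det_submatrix_equiv_self e.symm N]
  have : N.submatrix e.symm e.symm = Matrix.fromBlocks (N.submatrix some some) 0
      (Matrix.of fun _ j => N none (some j)) (Matrix.of fun _ _ => N none none) := by
    ext i j
    rcases i with i | i <;> rcases j with j | j <;> simp [e, hN]
  rw [this, Matrix.det_fromBlocks_zero₁₂, mul_comm]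
  simp

/-- On the hyperplane the column `none` vanishes outside row `none`, so the matrix is block
triangular: a normal entry times a tangential block. -/
lemma restrictPoly_det {M : Option J → Option J → MvPolynomial (Option J) K}
    (hM : ∀ j, restrictPoly (M (some j) none) = 0) :
    restrictPoly (Matrix.of M).det = restrictPoly (M none none) *
      (Matrix.of fun i j => restrictPoly (M (some i) (some j))).det := by
  rw [AlgHom.map_det, det_option_of_col_eq_zero _ (by simpa using hM)]
  rfl

/-- For a hyperplane, whose form is the coordinate `none`, of an arrangement `T` with deletion `T'`:
homogeneous derivations, all but one of them logarithmic for `T` and one for `T'`, that form a basis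
of the module of `T'`. -/
def HasAdaptedBasis (T T' : Finset X) (a : X → Option J → K) : Prop :=
  ∃ (M : Option J → Option J → MvPolynomial (Option J) K) (d : Option J → ℕ),
    (∀ j, M (some j) ∈ logDer T a) ∧ M none ∈ logDer T' a ∧
    (∀ i j, (M i j).IsHomogeneous (d i)) ∧
    (∃ c : K, c ≠ 0 ∧ (Matrix.of M).det = C c * definingPoly T' a)

variable [DecidableEq X] [DecidableEq Y] {T : Finset X} {a : X → Option J → K} {T'' : Finset Y}
  {a'' : Y → J → K} {π : X → Y} {h : X}

lemma restrictPoly_none_eq_zero (hh : h ∈ T) (ha : a h = Pi.single none 1)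
    {θ : Option J → MvPolynomial (Option J) K} (hθ : θ ∈ logDer T a) :
    restrictPoly (θ none) = 0 := by
  have := hθ h hh
  rw [ha, pairing_single, linForm_single, C_1, one_mul] at this
  exact restrictPoly_eq_zero_iff.2 this

lemma RestrictsTo.restrict_mem (hR : RestrictsTo (T.erase h) a T'' a'' π) (hh : h ∈ T)
    (ha : a h = Pi.single none 1)
    {θ : Option J → MvPolynomial (Option J) K} (hθ : θ ∈ logDer T a) :
    (fun j => restrictPoly (θ (some j))) ∈ logDer T'' a'' := fun y hy => by
  rw [← hR.image_eq, Finset.mem_image] at hy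
  obtain ⟨x, hx, rfl⟩ := hy
  obtain ⟨c, hc, hac⟩ := hR.exists_smul x hx
  have := map_dvd restrictPoly (hθ x (Finset.mem_of_mem_erase hx))
  rw [restrictPoly_linForm, restrictPoly_pairing (restrictPoly_none_eq_zero hh ha hθ), hac,
    linForm_smul, pairing_smul_left] at this
  have hu : IsUnit (C c : MvPolynomial J K) := (isUnit_iff_ne_zero.2 hc).map C
  exact (hu.dvd_mul_left).1 ((hu.mul_left_dvd).1 this)

lemma RestrictsTo.restrictPoly_definingPoly_ne_zero (hR : RestrictsTo (T.erase h) a T'' a'' π)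
    (hT'' : Reduced T'' a'') : restrictPoly (definingPoly (T.erase h) a) ≠ 0 := by
  rw [definingPoly, map_prod]
  refine Finset.prod_ne_zero_iff.2 fun x hx => ?_
  obtain ⟨c, hc, hac⟩ := hR.exists_smul x hx
  rw [restrictPoly_linForm, hac, linForm_smul]
  refine mul_ne_zero (by simpa using hc) (linForm_ne_zero (hT''.ne_zero _ ?_))
  rw [← hR.image_eq]
  exact Finset.mem_image_of_mem π hx

/-- An adapted basis yields homogeneous bases for the deletion, the restriction and the
arrangement itself. -/
lemma HasAdaptedBasis.exists_isHomogeneousBasis (hA : HasAdaptedBasis T (T.erase h) a)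
    (hR : RestrictsTo (T.erase h) a T'' a'' π) (hT : Reduced T a) (hT'' : Reduced T'' a'')
    (hh : h ∈ T) (ha : a h = Pi.single none 1) :
    ∃ (d : Option J → ℕ) (θ' θ : Option J → Option J → MvPolynomial (Option J) K)
      (θ'' : J → J → MvPolynomial J K),
      IsHomogeneousBasis (T.erase h) a θ' d ∧
      IsHomogeneousBasis T a θ (Function.update d none (d none + 1)) ∧
      IsHomogeneousBasis T'' a'' θ'' (fun j => d (some j)) := by
  obtain ⟨M, d, hM, hM0, hd, c, hc, hdet⟩ := hA
  have hT' : Reduced (T.erase h) a := hT.mono (Finset.erase_subset _ _)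
  have hne : (Matrix.of M).det ≠ 0 := by
    rw [hdet]
    exact mul_ne_zero (by simpa using hc) hT'.definingPoly_ne_zero
  have hmem : ∀ i, M i ∈ logDer (T.erase h) a := by
    rintro (_ | j)
    · exact hM0
    · exact logDer_anti a (Finset.erase_subset _ _) (hM j)
  have hsum : ∑ i, d i = (T.erase h).card :=
    (isHomogeneous_det (M := Matrix.of M) hd).inj_right
      (hdet ▸ (isHomogeneous_definingPoly _ a).C_mul c) hne
  have hres : restrictPoly (Matrix.of M).det ≠ 0 := by
    rw [hdet, map_mul, restrictPoly_C]
    exact mul_ne_zero (by simpa using hc) (hR.restrictPoly_definingPoly_ne_zero hT'')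
  -- The defining polynomial of the deletion does not vanish on the hyperplane, so both factors are
  -- nonzero: the normal value of `M none` and the determinant of the restricted derivations.
  rw [restrictPoly_det fun j => restrictPoly_none_eq_zero hh ha (hM j)] at hres
  have hd'' : ∀ i j, (restrictPoly (M (some i) (some j))).IsHomogeneous (d (some i)) :=
    fun i j => isHomogeneous_restrictPoly (hd _ _)
  have hmem'' : ∀ i, (fun j => restrictPoly (M (some i) (some j))) ∈ logDer T'' a'' :=
    fun i => hR.restrict_mem hh ha (hM i)
  have hdet'' := right_ne_zero_of_mul hres
  refine ⟨d, M, Function.update M none ((MvPolynomial.X none : MvPolynomial (Option J) K) • M none),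
    fun i j => restrictPoly (M (some i) (some j)),
    hT'.isHomogeneousBasis hmem hd hne hsum, hT.isHomogeneousBasis ?_ ?_ ?_ ?_,
    hT''.isHomogeneousBasis hmem'' hd'' hdet'' (le_antisymm ?_ ?_)⟩
  · rintro (_ | j)
    · rw [Function.update_self]
      intro x hx
      by_cases hxh : x = h
      · rw [hxh, ha, pairing_single, linForm_single, C_1, one_mul, Pi.smul_apply, smul_eq_mul]
        exact dvd_mul_right _ _
      · rw [map_smul, smul_eq_mul]
        exact (hM0 x (Finset.mem_erase.2 ⟨hxh, hx⟩)).mul_left _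
    · simpa using hM j
  · rintro (_ | i) j
    · rw [Function.update_self, Function.update_self, add_comm]
      exact (isHomogeneous_X K none).mul (hd none j)
    · simpa using hd (some i) j
  · have : Matrix.of (Function.update M none
        ((MvPolynomial.X none : MvPolynomial (Option J) K) • M none)) =
        (Matrix.of M).updateRow none
          ((MvPolynomial.X none : MvPolynomial (Option J) K) • M none) := rfl
    rw [this, Matrix.det_updateRow_smul]
    refine mul_ne_zero (X_ne_zero _) ?_
    rwa [show M none = Matrix.of M none from rfl, Matrix.updateRow_eq_self]
  · rw [Fintype.sum_option] at hsum ⊢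
    rw [Finset.card_erase_of_mem hh] at hsum
    have := Finset.card_pos.2 ⟨h, hh⟩
    simp
    omega
  -- Upper bound for the degrees of the restricted derivations: `B` divides the nonzero normal value
  -- of `M none`, so `d none ≥ β`, and the other degrees sum to at most |T'| − β = |T''|.
  · obtain ⟨B, β, hB0, hβ, hB, hdvd⟩ := hR.exists_dvd hT' hT''
    have h0 := left_ne_zero_of_mul hres
    have h1 := totalDegree_le_of_dvd_of_isDomain (hdvd _ hM0) h0
    rw [hB.totalDegree hB0, (isHomogeneous_restrictPoly (hd none none)).totalDegree h0] at h1
    rw [Fintype.sum_option] at hsum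
    omega
  -- Lower bound: the defining polynomial of the restriction divides the nonzero restricted
  -- determinant.
  · have h1 := totalDegree_le_of_dvd_of_isDomain
      (hT''.definingPoly_dvd_det (M := Matrix.of fun i j => restrictPoly (M (some i) (some j)))
        hmem'') hdet''
    rwa [(isHomogeneous_definingPoly _ _).totalDegree hT''.definingPoly_ne_zero,
      (isHomogeneous_det (M := Matrix.of fun i j => restrictPoly (M (some i) (some j)))
        hd'').totalDegree hdet''] at h1

/-- Adapted bases localize. -/
lemma HasAdaptedBasis.localize [DecidableEq K] (hA : HasAdaptedBasis T (T.erase h) a)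
    (hT : Reduced T a) (u : Option J → K) :
    HasAdaptedBasis {x ∈ T | a x ⬝ᵥ u = 0} ({x ∈ T | a x ⬝ᵥ u = 0}.erase h) a := by
  obtain ⟨M, d, hM, hM0, hd, c, hc, hdet⟩ := hA
  have hT' : Reduced (T.erase h) a := hT.mono (Finset.erase_subset _ _)
  obtain ⟨M', d', hM', hd', hdet', hsum⟩ := exists_localized_derivations
    (S := fun o => o.elim (T.erase h) fun _ => T) hT' (M := M)
    (by rintro (_ | j); exacts [hM0, hM j]) hc hdet u
  rw [← Finset.filter_erase]
  refine ⟨M', d', fun j => hM' (some j), hM' none, hd', ?_⟩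
  have hT'u : Reduced {x ∈ T.erase h | a x ⬝ᵥ u = 0} a := hT'.mono (Finset.filter_subset _ _)
  refine exists_C_of_dvd_isHomogeneous (isHomogeneous_definingPoly _ a)
    (hsum ▸ isHomogeneous_det (M := Matrix.of M') hd') hdet' (hT'u.definingPoly_dvd_det ?_)
  rintro (_ | j)
  · exact hM' none
  · exact logDer_anti a (Finset.filter_subset_filter _ (Finset.erase_subset _ _)) (hM' (some j))

end Triple

/-! ### Graded pieces of polynomial rings, with integer degrees so that shifts are unrestricted -/

section GradedPieces

variable (K : Type*) [Field K] (I : Type*)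

/-- The homogeneous polynomials of degree `n`, for an integer `n`. -/
noncomputable def polyPiece (n : ℤ) : Submodule K (MvPolynomial I K) :=
  if 0 ≤ n then homogeneousSubmodule I K n.toNat else ⊥

variable {K I}

lemma mem_polyPiece_natCast {f : MvPolynomial I K} {n : ℕ} :
    f ∈ polyPiece K I n ↔ f.IsHomogeneous n := by
  simp [polyPiece]

lemma polyPiece_of_neg {n : ℤ} (hn : n < 0) : polyPiece K I n = ⊥ := by
  rw [polyPiece, if_neg (by omega)]

lemma mul_mem_polyPiece {f g : MvPolynomial I K} {d : ℕ} {n : ℤ} (hf : f.IsHomogeneous d)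
    (hg : g ∈ polyPiece K I n) : f * g ∈ polyPiece K I (n + d) := by
  rcases lt_or_ge n 0 with hn | hn
  · rw [polyPiece_of_neg hn, Submodule.mem_bot] at hg
    simp [hg]
  · lift n to ℕ using hn
    rw [mem_polyPiece_natCast] at hg
    rw [← Nat.cast_add, mem_polyPiece_natCast, add_comm]
    exact hf.mul hg

lemma mem_polyPiece_of_mul_mem {f g : MvPolynomial I K} {d : ℕ} {n : ℤ} (hf : f.IsHomogeneous d)
    (hf0 : f ≠ 0) (h : f * g ∈ polyPiece K I n) : g ∈ polyPiece K I (n - d) := by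
  rcases eq_or_ne g 0 with rfl | hg
  · simp
  rcases lt_or_ge n 0 with hn | hn
  · rw [polyPiece_of_neg hn, Submodule.mem_bot] at h
    exact absurd h (mul_ne_zero hf0 hg)
  · lift n to ℕ using hn
    rw [mem_polyPiece_natCast] at h
    have h1 := homogeneousComponent_eq_self h
    rw [homogeneousComponent_mul_of_isHomogeneous hf] at h1
    split_ifs at h1 with hdn
    · rw [← Nat.cast_sub hdn, mem_polyPiece_natCast, ← mul_left_cancel₀ hf0 h1]
      exact homogeneousComponent_isHomogeneous _ _
    · exact absurd h1.symm (mul_ne_zero hf0 hg)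

instance finiteDimensional_polyPiece [Finite I] (n : ℤ) :
    FiniteDimensional K (polyPiece K I n) := by
  rcases lt_or_ge n 0 with hn | hn
  · rw [polyPiece_of_neg hn]
    infer_instance
  · rw [polyPiece, if_pos hn]
    exact Module.Finite.iff_fg.2 (homogeneousSubmodule_fg I K _)

lemma finrank_polyPiece_zero_pos [Finite I] : 0 < Module.finrank K (polyPiece K I 0) := by
  refine Module.finrank_pos_iff_exists_ne_zero.2 ⟨⟨1, ?_⟩,
    fun h => one_ne_zero (congrArg Subtype.val h)⟩
  exact mem_polyPiece_natCast.2 (isHomogeneous_one I K)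

lemma finrank_map_add_finrank_inf_ker {V W : Type*} [AddCommGroup V] [Module K V]
    [AddCommGroup W] [Module K W] (f : V →ₗ[K] W) (P : Submodule K V) [FiniteDimensional K P] :
    Module.finrank K (P.map f) + Module.finrank K (P ⊓ LinearMap.ker f : Submodule K V) =
      Module.finrank K P := by
  have h : (P ⊓ LinearMap.ker f).comap P.subtype = (LinearMap.ker f).comap P.subtype := by
    ext x
    simp
  rw [← LinearMap.finrank_range_add_finrank_ker (f.domRestrict P), LinearMap.range_domRestrict,
    LinearMap.ker_domRestrict,
    ← (Submodule.comapSubtypeEquivOfLe (inf_le_left : P ⊓ LinearMap.ker f ≤ P)).finrank_eq, h]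

lemma finrank_map_of_injective {V W : Type*} [AddCommGroup V] [Module K V]
    [AddCommGroup W] [Module K W] {f : V →ₗ[K] W} (hf : Function.Injective f)
    (P : Submodule K V) : Module.finrank K (P.map f) = Module.finrank K P :=
  (Submodule.equivMapOfInjective f hf P).finrank_eq.symm

lemma restrictPoly_mem_polyPiece {J : Type*} {f : MvPolynomial (Option J) K} {n : ℤ}
    (hf : f ∈ polyPiece K (Option J) n) : restrictPoly f ∈ polyPiece K J n := by
  rcases lt_or_ge n 0 with hn | hn
  · rw [polyPiece_of_neg hn, Submodule.mem_bot] at hf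
    simp [hf]
  · lift n to ℕ using hn
    rw [mem_polyPiece_natCast] at hf ⊢
    exact isHomogeneous_restrictPoly hf

/-- The Hilbert function of a polynomial ring is the first difference of that of the polynomial
ring with one more variable. -/
lemma finrank_polyPiece_option {J : Type*} [Finite J] (n : ℤ) :
    Module.finrank K (polyPiece K (Option J) n) =
      Module.finrank K (polyPiece K J n) + Module.finrank K (polyPiece K (Option J) (n - 1)) := by
  have h0 := finrank_map_add_finrank_inf_ker
    (restrictPoly (K := K) (J := J)).toLinearMap (polyPiece K (Option J) n)
  have h1 : (polyPiece K (Option J) n).map (restrictPoly (K := K) (J := J)).toLinearMap =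
      polyPiece K J n := by
    refine le_antisymm (Submodule.map_le_iff_le_comap.2 fun f hf =>
      restrictPoly_mem_polyPiece hf) fun f hf => ⟨rename some f, ?_, restrictPoly_rename f⟩
    rcases lt_or_ge n 0 with hn | hn
    · rw [polyPiece_of_neg hn, Submodule.mem_bot] at hf
      simp [hf]
    · lift n to ℕ using hn
      rw [mem_polyPiece_natCast] at hf
      exact mem_polyPiece_natCast.2 hf.rename_isHomogeneous
  have h2 : polyPiece K (Option J) n ⊓
      LinearMap.ker (restrictPoly (K := K) (J := J)).toLinearMap =
      (polyPiece K (Option J) (n - 1)).map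
        (LinearMap.mulLeft K (X none : MvPolynomial (Option J) K)) := by
    ext f
    constructor
    · rintro ⟨hf, hf0⟩
      obtain ⟨g, rfl⟩ := restrictPoly_eq_zero_iff.1 hf0
      refine ⟨g, ?_, rfl⟩
      simpa using mem_polyPiece_of_mul_mem (isHomogeneous_X K none) (X_ne_zero _) hf
    · rintro ⟨g, hg, rfl⟩
      refine ⟨?_, by simp⟩
      have := mul_mem_polyPiece (isHomogeneous_X K none) hg
      simpa using this
  rw [h1, h2, finrank_map_of_injective (mul_right_injective₀ (X_ne_zero _))] at h0
  exact h0.symm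

end GradedPieces

/-! ### The Hilbert function of a free module of logarithmic derivations -/

section Count

variable {K : Type*} [Field K] {I : Type*} [Fintype I] {X : Type*}

/-- The homogeneous logarithmic derivations of degree `n`. -/
noncomputable def logDerPiece (T : Finset X) (a : X → I → K) (n : ℤ) :
    Submodule K (I → MvPolynomial I K) :=
  (logDer T a).restrictScalars K ⊓ Submodule.pi Set.univ fun _ => polyPiece K I n

lemma mem_logDerPiece {T : Finset X} {a : X → I → K} {n : ℤ} {θ : I → MvPolynomial I K} :
    θ ∈ logDerPiece T a n ↔ θ ∈ logDer T a ∧ ∀ i, θ i ∈ polyPiece K I n := by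
  simp [logDerPiece]

/-- The linear combinations of derivations of degrees `d i`, of total degree `n`. -/
noncomputable def combination (θ : I → I → MvPolynomial I K) (d : I → ℕ) (n : ℤ) :
    (∀ i, polyPiece K I (n - d i)) →ₗ[K] (I → MvPolynomial I K) where
  toFun g := ∑ i, (g i : MvPolynomial I K) • θ i
  map_add' g g' := by simp [add_smul, Finset.sum_add_distrib]
  map_smul' c g := by simp [Finset.smul_sum]

variable {T : Finset X} {a : X → I → K} {θ : I → I → MvPolynomial I K} {d : I → ℕ}

lemma combination_injective (h : IsHomogeneousBasis T a θ d) (hT : Reduced T a) (n : ℤ) :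
    Function.Injective (combination θ d n) := by
  classical
  rw [← LinearMap.ker_eq_bot, LinearMap.ker_eq_bot']
  intro g hg
  have := sum_smul_injective_of_det_ne_zero (M := Matrix.of θ) (h.det_ne_zero hT)
    (g := fun i => (g i : MvPolynomial I K)) hg
  funext i
  exact Subtype.ext (congrFun this i)

lemma range_combination (h : IsHomogeneousBasis T a θ d) (n : ℤ) :
    LinearMap.range (combination θ d n) = logDerPiece T a n := by
  ext η
  rw [mem_logDerPiece]
  constructor
  · rintro ⟨g, rfl⟩
    refine ⟨Submodule.sum_mem _ fun i _ => Submodule.smul_mem _ _ (h.mem i), fun j => ?_⟩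
    simp only [combination, LinearMap.coe_mk, AddHom.coe_mk, Finset.sum_apply, Pi.smul_apply,
      smul_eq_mul]
    refine Submodule.sum_mem _ fun i _ => ?_
    rw [mul_comm]
    simpa using mul_mem_polyPiece (h.isHomogeneous i j) (g i).2
  · rintro ⟨hη, hn⟩
    rcases lt_or_ge n 0 with hn0 | hn0
    · refine ⟨0, ?_⟩
      funext j
      have := hn j
      rw [polyPiece_of_neg hn0, Submodule.mem_bot] at this
      simp [this]
    · lift n to ℕ using hn0
      obtain ⟨g, hg⟩ := h.span η hη
      -- Only the component of degree `n - d i` of each coefficient matters. The case distinction is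
      -- needed because natural subtraction truncates.
      refine ⟨fun i => ⟨if d i ≤ n then homogeneousComponent (n - d i) (g i) else 0, ?_⟩, ?_⟩
      · split_ifs with hi
        · rw [← Nat.cast_sub hi, mem_polyPiece_natCast]
          exact homogeneousComponent_isHomogeneous _ _
        · exact zero_mem _
      · funext j
        rw [← homogeneousComponent_eq_self (mem_polyPiece_natCast.1 (hn j)), hg]
        simp only [combination, LinearMap.coe_mk, AddHom.coe_mk, Finset.sum_apply, Pi.smul_apply,
          smul_eq_mul, map_sum]
        refine Finset.sum_congr rfl fun i _ => ?_
        rw [mul_comm (g i), homogeneousComponent_mul_of_isHomogeneous (h.isHomogeneous i j)]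
        split_ifs <;> simp [mul_comm]

instance (n : ℤ) : FiniteDimensional K (logDerPiece T a n) :=
  have : FiniteDimensional K (Submodule.pi Set.univ fun _ : I => polyPiece K I n) :=
    Module.Finite.of_injective (LinearMap.pi fun i => LinearMap.codRestrict (polyPiece K I n)
      ((LinearMap.proj i : (I → MvPolynomial I K) →ₗ[K] _) ∘ₗ Submodule.subtype _)
        fun x => x.2 i trivial) fun _ _ hxy =>
        Subtype.ext (funext fun i => congrArg Subtype.val (congrFun hxy i))
  Submodule.finiteDimensional_of_le inf_le_right

lemma IsHomogeneousBasis.finrank_logDerPiece (h : IsHomogeneousBasis T a θ d) (hT : Reduced T a)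
    (n : ℤ) : Module.finrank K (logDerPiece T a n) =
      ∑ i, Module.finrank K (polyPiece K I (n - d i)) := by
  rw [← range_combination h, LinearMap.finrank_range_of_inj (combination_injective h hT n),
    Module.finrank_pi_fintype]

end Count

/-! ### Adapted bases from inclusions of exponents, by counting dimensions -/

section RestrictionCount

variable {K : Type*} [Field K] {J : Type*}

/-- The restriction of the value at the form of the hyperplane. -/
noncomputable def normalPart :
    (Option J → MvPolynomial (Option J) K) →ₗ[K] MvPolynomial J K :=
  restrictPoly.toLinearMap ∘ₗ LinearMap.proj none

lemma normalPart_apply (θ : Option J → MvPolynomial (Option J) K) :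
    normalPart θ = restrictPoly (θ none) := rfl

/-- The restriction of a derivation to the hyperplane. -/
noncomputable def tangentPart :
    (Option J → MvPolynomial (Option J) K) →ₗ[K] (J → MvPolynomial J K) :=
  LinearMap.pi fun j => restrictPoly.toLinearMap ∘ₗ LinearMap.proj (some j)

lemma tangentPart_apply (θ : Option J → MvPolynomial (Option J) K) (j : J) :
    tangentPart θ j = restrictPoly (θ (some j)) := rfl

variable [Fintype J] [DecidableEq J] {X Y : Type*} [DecidableEq X] [DecidableEq Y]
  {T : Finset X} {a : X → Option J → K} {T'' : Finset Y} {a'' : Y → J → K} {π : X → Y} {h : X}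

lemma mem_logDer_iff (hh : h ∈ T) (ha : a h = Pi.single none 1)
    {θ : Option J → MvPolynomial (Option J) K} :
    θ ∈ logDer T a ↔ θ ∈ logDer (T.erase h) a ∧ restrictPoly (θ none) = 0 := by
  refine ⟨fun hθ => ⟨logDer_anti a (Finset.erase_subset _ _) hθ,
    restrictPoly_none_eq_zero hh ha hθ⟩, fun hθ x hx => ?_⟩
  by_cases hxh : x = h
  · rw [hxh, ha, pairing_single, linForm_single, C_1, one_mul]
    exact restrictPoly_eq_zero_iff.1 hθ.2
  · exact hθ.1 x (Finset.mem_erase.2 ⟨hxh, hx⟩)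

/-- Rank-nullity: a derivation of the deletion is logarithmic for `T` exactly when its normal part
vanishes. -/
lemma finrank_map_normalPart (hh : h ∈ T) (ha : a h = Pi.single none 1) (n : ℤ) :
    Module.finrank K ((logDerPiece (T.erase h) a n).map normalPart) +
      Module.finrank K (logDerPiece T a n) =
      Module.finrank K (logDerPiece (T.erase h) a n) := by
  have hker : logDerPiece (T.erase h) a n ⊓ LinearMap.ker normalPart = logDerPiece T a n := by
    ext θ
    rw [Submodule.mem_inf, mem_logDerPiece, mem_logDerPiece, LinearMap.mem_ker, normalPart_apply,
      mem_logDer_iff hh ha]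
    tauto
  rw [← finrank_map_add_finrank_inf_ker normalPart (logDerPiece (T.erase h) a n), hker]

/-- Rank-nullity again: a derivation of `T` that restricts to zero is the coordinate `none` times a
derivation of the deletion, of degree one less. -/
lemma finrank_map_tangentPart (hT : Reduced T a) (hh : h ∈ T) (ha : a h = Pi.single none 1)
    (n : ℤ) :
    Module.finrank K ((logDerPiece T a n).map tangentPart) +
      Module.finrank K (logDerPiece (T.erase h) a (n - 1)) =
      Module.finrank K (logDerPiece T a n) := by
  have hX : (MvPolynomial.X none : MvPolynomial (Option J) K) ≠ 0 := X_ne_zero _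
  let f : (Option J → MvPolynomial (Option J) K) →ₗ[K] (Option J → MvPolynomial (Option J) K) :=
    LinearMap.lsmul (MvPolynomial (Option J) K) _ (MvPolynomial.X none) |>.restrictScalars K
  have hf : ∀ θ, f θ = (MvPolynomial.X none : MvPolynomial (Option J) K) • θ := fun _ => rfl
  have hker : logDerPiece T a n ⊓ LinearMap.ker tangentPart =
      (logDerPiece (T.erase h) a (n - 1)).map f := by
    ext θ
    symm
    constructor
    · rintro ⟨θ, hθ, rfl⟩
      rw [SetLike.mem_coe, mem_logDerPiece] at hθ
      rw [Submodule.mem_inf, mem_logDerPiece, LinearMap.mem_ker, mem_logDer_iff hh ha, hf]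
      refine ⟨⟨⟨Submodule.smul_mem _ _ hθ.1, by simp⟩, fun i => ?_⟩, ?_⟩
      · simpa using mul_mem_polyPiece (isHomogeneous_X K none) (hθ.2 i)
      · funext j
        simp [tangentPart_apply]
    · rintro ⟨hθ, hθ0⟩
      rw [SetLike.mem_coe, mem_logDerPiece] at hθ
      have hdvd : ∀ o, MvPolynomial.X none ∣ θ o := by
        rintro (_ | j)
        · exact restrictPoly_eq_zero_iff.1 (restrictPoly_none_eq_zero hh ha hθ.1)
        · exact restrictPoly_eq_zero_iff.1 (congrFun hθ0 j)
      choose η hη using hdvd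
      have hη : θ = (MvPolynomial.X none : MvPolynomial (Option J) K) • η := funext hη
      refine ⟨η, ?_, hη.symm⟩
      rw [SetLike.mem_coe, mem_logDerPiece]
      refine ⟨fun x hx => ?_, fun o => ?_⟩
      · rw [Finset.mem_erase] at hx
        have h1 := hθ.1 x hx.2
        rw [hη, map_smul, smul_eq_mul] at h1
        -- The form of `x ≠ h` is prime and does not divide the coordinate `none`, so it divides the
        -- value of the quotient `η`.
        refine ((prime_linForm (hT.ne_zero x hx.2)).dvd_or_dvd h1).resolve_left fun h2 => ?_
        rw [← linForm_single, ← ha] at h2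
        exact hT.not_dvd hx.2 hh hx.1 h2
      · have h1 := hθ.2 o
        rw [hη] at h1
        simpa using mem_polyPiece_of_mul_mem (isHomogeneous_X K none) hX h1
  rw [← finrank_map_add_finrank_inf_ker tangentPart (logDerPiece T a n), hker,
    finrank_map_of_injective (f := f) (smul_right_injective _ hX)]

lemma finrank_map_normalPart_le {T' : Finset X} {B : MvPolynomial J K} {β : ℕ} (hB0 : B ≠ 0)
    (hB : B.IsHomogeneous β) (hdvd : ∀ θ ∈ logDer T' a, B ∣ restrictPoly (θ none)) (n : ℤ) :
    Module.finrank K ((logDerPiece T' a n).map normalPart) ≤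
      Module.finrank K (polyPiece K J (n - β)) := by
  rw [← finrank_map_of_injective (f := LinearMap.mulLeft K B) (mul_right_injective₀ hB0)
    (polyPiece K J (n - β))]
  refine Submodule.finrank_mono ?_
  rintro _ ⟨θ, hθ, rfl⟩
  rw [SetLike.mem_coe, mem_logDerPiece] at hθ
  obtain ⟨g, hg⟩ := hdvd θ hθ.1
  have := restrictPoly_mem_polyPiece (hθ.2 none)
  rw [hg] at this
  exact ⟨g, mem_polyPiece_of_mul_mem hB hB0 this, hg.symm⟩

lemma RestrictsTo.map_tangentPart_le (hR : RestrictsTo (T.erase h) a T'' a'' π) (hh : h ∈ T)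
    (ha : a h = Pi.single none 1) (n : ℤ) :
    (logDerPiece T a n).map tangentPart ≤ logDerPiece T'' a'' n := by
  rintro _ ⟨θ, hθ, rfl⟩
  rw [SetLike.mem_coe, mem_logDerPiece] at hθ
  exact mem_logDerPiece.2 ⟨hR.restrict_mem hh ha hθ.1,
    fun j => restrictPoly_mem_polyPiece (hθ.2 (some j))⟩

/-- If every homogeneous logarithmic derivation of the restriction lifts, and some derivation of the
deletion of the right degree is not tangent to the hyperplane, there is an adapted basis. -/
lemma hasAdaptedBasis_of_lift (hT : Reduced T a)
    (hT'' : Reduced T'' a'') (hh : h ∈ T) (ha : a h = Pi.single none 1)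
    {θ'' : J → J → MvPolynomial J K} {e : J → ℕ} (hθ'' : IsHomogeneousBasis T'' a'' θ'' e)
    {β : ℕ} (hβ : T''.card + β = (T.erase h).card)
    (hlift : ∀ n : ℕ, logDerPiece T'' a'' n ≤ (logDerPiece T a n).map tangentPart)
    (hnormal : ∃ θ ∈ logDerPiece (T.erase h) a β, normalPart θ ≠ 0) :
    HasAdaptedBasis T (T.erase h) a := by
  obtain ⟨θ₀, hθ₀, hne⟩ := hnormal
  have hT' : Reduced (T.erase h) a := hT.mono (Finset.erase_subset _ _)
  choose η hη hηθ using fun j => hlift (e j) (mem_logDerPiece.2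
    ⟨hθ''.mem j, fun i => mem_polyPiece_natCast.2 (hθ''.isHomogeneous j i)⟩)
  simp only [SetLike.mem_coe, mem_logDerPiece, mem_polyPiece_natCast] at hη hθ₀
  let M : Option J → Option J → MvPolynomial (Option J) K := fun o => o.elim θ₀ η
  have hd : ∀ i j, (M i j).IsHomogeneous (i.elim β e) := by
    rintro (_ | i) j
    · exact hθ₀.2 j
    · exact (hη i).2 j
  have hmem : ∀ i, M i ∈ logDer (T.erase h) a := by
    rintro (_ | i)
    · exact hθ₀.1
    · exact logDer_anti a (Finset.erase_subset _ _) (hη i).1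
  have hdet : (Matrix.of M).det ≠ 0 := by
    -- On the hyperplane the determinant becomes the normal part of `θ₀` times the determinant of
    -- the basis `θ''`; both are nonzero.
    intro h0
    have h1 := restrictPoly_det (M := M) fun j => restrictPoly_none_eq_zero hh ha (hη j).1
    rw [h0, map_zero] at h1
    refine mul_ne_zero hne ?_ h1.symm
    have h2 : (Matrix.of fun i j => restrictPoly (M (some i) (some j))) = Matrix.of θ'' := by
      ext1 i j
      exact congrFun (hηθ i) j
    rw [h2]
    exact hθ''.det_ne_zero hT''
  have hsum : ∑ i : Option J, i.elim β e = (T.erase h).card := by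
    rw [Fintype.sum_option, ← hβ, ← hθ''.sum_eq_card hT'', add_comm]
    rfl
  exact ⟨M, _, fun j => (hη j).1, hθ₀.1, hd, exists_C_of_dvd_isHomogeneous
    (isHomogeneous_definingPoly _ a) (hsum ▸ isHomogeneous_det (M := Matrix.of M) hd) hdet
    (hT'.definingPoly_dvd_det hmem)⟩

lemma sum_comp_eq {ι κ : Type*} [Fintype ι] [Fintype κ] {d : ι → ℕ} {e : κ → ℕ} {b : ℕ}
    (hde : Finset.univ.val.map d = b ::ₘ Finset.univ.val.map e) (F : ℕ → ℕ) :
    ∑ i, F (d i) = F b + ∑ j, F (e j) := by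
  have := congrArg (fun s => (Multiset.map F s).sum) hde
  rwa [Multiset.map_cons, Multiset.sum_cons, Multiset.map_map, Multiset.map_map] at this

lemma sum_finrank_polyPiece_option {ι : Type*} [Fintype ι] (d : ι → ℕ) (n : ℤ) :
    ∑ i, Module.finrank K (polyPiece K (Option J) (n - d i)) =
      ∑ i, Module.finrank K (polyPiece K J (n - d i)) +
        ∑ i, Module.finrank K (polyPiece K (Option J) (n - 1 - d i)) := by
  rw [← Finset.sum_add_distrib]
  refine Finset.sum_congr rfl fun i _ => ?_
  rw [finrank_polyPiece_option, sub_right_comm n 1]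

/-- If deletion and restriction are free and the exponents of the restriction are contained in
those of the deletion, there is an adapted basis. -/
lemma RestrictsTo.hasAdaptedBasis_of_deletion (hR : RestrictsTo (T.erase h) a T'' a'' π)
    (hT : Reduced T a) (hT'' : Reduced T'' a'') (hh : h ∈ T) (ha : a h = Pi.single none 1)
    {θ' : Option J → Option J → MvPolynomial (Option J) K} {d : Option J → ℕ}
    (hθ' : IsHomogeneousBasis (T.erase h) a θ' d)
    {θ'' : J → J → MvPolynomial J K} {e : J → ℕ} (hθ'' : IsHomogeneousBasis T'' a'' θ'' e) {b : ℕ}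
    (hde : Finset.univ.val.map d = b ::ₘ Finset.univ.val.map e) :
    HasAdaptedBasis T (T.erase h) a := by
  have hT' : Reduced (T.erase h) a := hT.mono (Finset.erase_subset _ _)
  obtain ⟨B, β, hB0, hβ, hB, hdvd⟩ := hR.exists_dvd hT' hT''
  -- The exponents of a free arrangement sum to its number of hyperplanes, so the surplus exponent
  -- is |T'| − |T''|.
  have hbβ : b = β := by
    have := sum_comp_eq hde id
    simp only [id] at this
    rw [hθ'.sum_eq_card hT', hθ''.sum_eq_card hT''] at this
    omega
  subst hbβ
  -- By `h1` and `h2` the two images have total dimension dim D(A')_n − dim D(A')_{n−1}. By the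
  -- exponents (`h5` to `h8`) this is dim S''_{n−b} + dim D(A'')_n, the sum of the upper bounds `h3`
  -- and `h4`. So neither bound is strict.
  have key : ∀ n : ℤ,
      Module.finrank K (logDerPiece T'' a'' n) ≤
        Module.finrank K ((logDerPiece T a n).map tangentPart) ∧
      Module.finrank K (polyPiece K J (n - b)) ≤
        Module.finrank K ((logDerPiece (T.erase h) a n).map normalPart) := by
    intro n
    have h1 := finrank_map_normalPart hh ha n
    have h2 := finrank_map_tangentPart hT hh ha n
    have h3 := finrank_map_normalPart_le hB0 hB hdvd n
    have h4 := Submodule.finrank_mono (hR.map_tangentPart_le hh ha n)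
    have h5 := hθ'.finrank_logDerPiece hT' n
    have h6 := hθ'.finrank_logDerPiece hT' (n - 1)
    have h7 := hθ''.finrank_logDerPiece hT'' n
    have h8 := sum_comp_eq hde fun i => Module.finrank K (polyPiece K J (n - i))
    rw [sum_finrank_polyPiece_option] at h5
    omega
  refine hasAdaptedBasis_of_lift hT hT'' hh ha hθ'' hβ (fun n => ?_) ?_
  · exact (Submodule.eq_of_le_of_finrank_le (hR.map_tangentPart_le hh ha n) (key n).1).ge
  -- In degree `b` the normal image has the dimension of the constants, so it is not zero.
  · by_contra! h0
    have hbot : (logDerPiece (T.erase h) a b).map normalPart = ⊥ :=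
      eq_bot_iff.2 (Submodule.map_le_iff_le_comap.2 h0)
    have h1 := (key b).2
    rw [sub_self, hbot, finrank_bot] at h1
    exact absurd h1 (not_le.2 finrank_polyPiece_zero_pos)

/-- If an arrangement and its restriction are free and the exponents of the restriction are
contained in those of the arrangement, there is an adapted basis. -/
lemma RestrictsTo.hasAdaptedBasis_of_addition (hR : RestrictsTo (T.erase h) a T'' a'' π)
    (hT : Reduced T a) (hT'' : Reduced T'' a'') (hh : h ∈ T) (ha : a h = Pi.single none 1)
    {θ : Option J → Option J → MvPolynomial (Option J) K} {d : Option J → ℕ}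
    (hθ : IsHomogeneousBasis T a θ d)
    {θ'' : J → J → MvPolynomial J K} {e : J → ℕ} (hθ'' : IsHomogeneousBasis T'' a'' θ'' e) {b : ℕ}
    (hde : Finset.univ.val.map d = b ::ₘ Finset.univ.val.map e) :
    HasAdaptedBasis T (T.erase h) a := by
  have hT' : Reduced (T.erase h) a := hT.mono (Finset.erase_subset _ _)
  obtain ⟨B, β, hB0, hβ, hB, hdvd⟩ := hR.exists_dvd hT' hT''
  -- Now the larger exponents belong to `T`, which has one hyperplane more than the deletion.
  have hbβ : b = β + 1 := by
    have := sum_comp_eq hde id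
    simp only [id] at this
    rw [hθ.sum_eq_card hT, hθ''.sum_eq_card hT''] at this
    have := Finset.card_erase_add_one hh
    omega
  subst hbβ
  -- The same count with the difference dim D(A)_n − dim D(A)_{n−1}: it is the dimension of the
  -- tangent image in degree `n` plus that of the normal image in degree `n - 1`.
  have key : ∀ n : ℤ,
      Module.finrank K (logDerPiece T'' a'' n) ≤
        Module.finrank K ((logDerPiece T a n).map tangentPart) ∧
      Module.finrank K (polyPiece K J (n - (β + 1 : ℕ))) ≤
        Module.finrank K ((logDerPiece (T.erase h) a (n - 1)).map normalPart) := by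
    intro n
    have h1 := finrank_map_normalPart hh ha (n - 1)
    have h2 := finrank_map_tangentPart hT hh ha n
    have h3 := finrank_map_normalPart_le hB0 hB hdvd (n - 1)
    have h4 := Submodule.finrank_mono (hR.map_tangentPart_le hh ha n)
    have h5 := hθ.finrank_logDerPiece hT n
    have h6 := hθ.finrank_logDerPiece hT (n - 1)
    have h7 := hθ''.finrank_logDerPiece hT'' n
    have h8 := sum_comp_eq hde fun i => Module.finrank K (polyPiece K J (n - i))
    rw [sum_finrank_polyPiece_option] at h5
    rw [show n - 1 - (β : ℤ) = n - (β + 1 : ℕ) by push_cast; ring] at h3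
    omega
  refine hasAdaptedBasis_of_lift hT hT'' hh ha hθ'' hβ (fun n => ?_) ?_
  · exact (Submodule.eq_of_le_of_finrank_le (hR.map_tangentPart_le hh ha n) (key n).1).ge
  · by_contra! h0
    have hbot : (logDerPiece (T.erase h) a β).map normalPart = ⊥ :=
      eq_bot_iff.2 (Submodule.map_le_iff_le_comap.2 h0)
    have h1 := (key (β + 1 : ℕ)).2
    rw [sub_self, show ((β + 1 : ℕ) : ℤ) - 1 = β by push_cast; ring,
      hbot, finrank_bot] at h1
    exact absurd h1 (not_le.2 finrank_polyPiece_zero_pos)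

end RestrictionCount

/-! ### Choosing a linear form for each hyperplane -/

section FormOf

variable {K : Type*} [Field K] {V : Type*} [AddCommGroup V] [Module K V]

lemma exists_eq_smul_of_ker_le {α β : Module.Dual K V} (h : LinearMap.ker α ≤ LinearMap.ker β) :
    ∃ c : K, β = c • α := by
  have := mem_span_of_iInf_ker_le_ker (L := fun _ : Unit => α) (K := β) (by simpa using h)
  rw [Set.range_const, Submodule.mem_span_singleton] at this
  obtain ⟨c, hc⟩ := this
  exact ⟨c, hc.symm⟩

open Classical in
/-- A linear form with a given kernel. -/
noncomputable def formOf (H : Submodule K V) : Module.Dual K V :=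
  if h : ∃ α : Module.Dual K V, α ≠ 0 ∧ LinearMap.ker α = H then h.choose else 0

lemma formOf_spec {H : Submodule K V} (h : ∃ α : Module.Dual K V, α ≠ 0 ∧ LinearMap.ker α = H) :
    formOf H ≠ 0 ∧ LinearMap.ker (formOf H) = H := by
  rw [formOf, dif_pos h]
  exact h.choose_spec

lemma eq_of_le {A : HyperplaneArrangement K V} {H H' : Submodule K V} (hH : H ∈ A.carrier)
    (hH' : H' ∈ A.carrier) (h : H ≤ H') : H = H' := by
  obtain ⟨α, hα, rfl⟩ := A.exists_form H hH
  obtain ⟨β, hβ, rfl⟩ := A.exists_form H' hH'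
  obtain ⟨c, rfl⟩ := exists_eq_smul_of_ker_le h
  rw [LinearMap.ker_smul]
  rintro rfl
  simp at hβ

/-- The hyperplanes of an arrangement. -/
noncomputable def hyperplanes (A : HyperplaneArrangement K V) : Finset (Submodule K V) :=
  A.finite_carrier.toFinset

@[simp] lemma mem_hyperplanes {A : HyperplaneArrangement K V} {H : Submodule K V} :
    H ∈ A.hyperplanes ↔ H ∈ A.carrier := Set.Finite.mem_toFinset _

variable {I : Type*} [Fintype I]

/-- The coefficients of the form with a given kernel, in a basis of the dual space. -/
noncomputable def formCoeffs (b : Module.Basis I K (Module.Dual K V)) (H : Submodule K V) : I → K :=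
  b.equivFun (formOf H)

lemma reduced_formCoeffs (b : Module.Basis I K (Module.Dual K V)) (A : HyperplaneArrangement K V) :
    Reduced A.hyperplanes (formCoeffs b) := by
  refine ⟨fun H hH => ?_, fun H hH H' hH' c hc => ?_⟩
  · exact (b.equivFun.map_ne_zero_iff).2 (formOf_spec (A.exists_form H (mem_hyperplanes.1 hH))).1
  · rw [mem_hyperplanes] at hH hH'
    have h1 := formOf_spec (A.exists_form H hH)
    have h2 := formOf_spec (A.exists_form H' hH')
    rw [formCoeffs, formCoeffs, ← map_smul, b.equivFun.injective.eq_iff] at hc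
    refine (eq_of_le hH' hH ?_).symm
    rw [← h1.2, ← h2.2, hc]
    exact LinearMap.ker_le_ker_smul _ _

end FormOf

/-! ### Passing between derivations of S(V*) and coordinate vectors -/

section Transfer

variable {K : Type*} [Field K] {V : Type*} [AddCommGroup V] [Module K V] {I : Type*} [Fintype I]
  (b : Module.Basis I K (Module.Dual K V))

/-- The coordinates on `S`. -/
noncomputable abbrev polyEquiv : PolyRing K V ≃ₐ[K] MvPolynomial I K :=
  SymmetricAlgebra.equivMvPolynomial b

lemma polyEquiv_form (α : Module.Dual K V) :
    polyEquiv b (form α) = linForm (b.equivFun α) := by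
  calc polyEquiv b (form α) = polyEquiv b (form (∑ i, b.equivFun α i • b i)) := by
        rw [b.sum_equivFun]
    _ = linForm (b.equivFun α) := by
        simp only [form, map_sum, map_smul, SymmetricAlgebra.equivMvPolynomial_ι_apply,
          smul_eq_C_mul, linForm_eq]

lemma map_polyEquiv_gradedPiece (p : ℕ) :
    (gradedPiece K V p).map (polyEquiv b).toLinearMap = homogeneousSubmodule I K p := by
  have h1 : (LinearMap.range (SymmetricAlgebra.ι K (Module.Dual K V))).map
      (polyEquiv b).toLinearMap = homogeneousSubmodule I K 1 := by
    rw [homogeneousSubmodule_one_eq_span_X, ← Submodule.map_top, ← b.span_eq, Submodule.map_span,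
      Submodule.map_span, ← Set.range_comp, ← Set.range_comp]
    congr 2
    funext i
    simp
  rw [gradedPiece, ← homogeneousSubmodule_one_pow, ← h1]
  exact Submodule.map_pow _ (polyEquiv b).toAlgHom _

lemma isHomogeneous_polyEquiv_iff {f : PolyRing K V} {p : ℕ} :
    (polyEquiv b f).IsHomogeneous p ↔ f ∈ gradedPiece K V p := by
  rw [← mem_homogeneousSubmodule, ← map_polyEquiv_gradedPiece b]
  exact (polyEquiv b).injective.mem_set_image

/-- The coordinates of a derivation. -/
noncomputable def coords (θ : Derivation K (PolyRing K V) (PolyRing K V)) : I → MvPolynomial I K :=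
  fun i => polyEquiv b (θ (form (b i)))

lemma pairing_coords (θ : Derivation K (PolyRing K V) (PolyRing K V)) (α : Module.Dual K V) :
    pairing (b.equivFun α) (coords b θ) = polyEquiv b (θ (form α)) := by
  symm
  calc polyEquiv b (θ (form α)) = polyEquiv b (θ (form (∑ i, b.equivFun α i • b i))) := by
        rw [b.sum_equivFun]
    _ = pairing (b.equivFun α) (coords b θ) := by
        simp only [form, map_sum, Derivation.map_smul, map_smul, smul_eq_C_mul,
          pairing_apply, coords]

/-- The derivation with given coordinates. -/
noncomputable def ofCoords (f : I → MvPolynomial I K) :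
    Derivation K (PolyRing K V) (PolyRing K V) :=
  Derivation.mk' ((polyEquiv b).symm.toLinearMap ∘ₗ (mkDerivation K f).toLinearMap ∘ₗ
    (polyEquiv b).toLinearMap) fun x y => by simp

lemma coords_ofCoords (f : I → MvPolynomial I K) : coords b (ofCoords b f) = f := by
  funext i
  change polyEquiv b ((polyEquiv b).symm (mkDerivation K f (polyEquiv b (form (b i))))) = f i
  rw [AlgEquiv.apply_symm_apply, SymmetricAlgebra.equivMvPolynomial_ι_apply, mkDerivation_X]

lemma coords_injective : Function.Injective (coords b) := by
  intro θ θ' h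
  let toPoly : Derivation K (PolyRing K V) (PolyRing K V) →
      Derivation K (MvPolynomial I K) (MvPolynomial I K) := fun θ =>
    Derivation.mk' ((polyEquiv b).toLinearMap ∘ₗ θ.toLinearMap ∘ₗ
      (polyEquiv b).symm.toLinearMap) fun x y => by simp
  have happly : ∀ θ f, toPoly θ f = polyEquiv b (θ ((polyEquiv b).symm f)) := fun _ _ => rfl
  have hpoly : toPoly θ = toPoly θ' := MvPolynomial.derivation_ext fun i => by
    rw [happly, happly, SymmetricAlgebra.equivMvPolynomial_symm_X]
    exact congrFun h i
  ext x
  have := congrArg (fun D => D (polyEquiv b x)) hpoly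
  simp only [happly, AlgEquiv.symm_apply_apply] at this
  exact (polyEquiv b).injective this

lemma coords_sum_smul {ι : Type*} (s : Finset ι) (g : ι → PolyRing K V)
    (θ : ι → Derivation K (PolyRing K V) (PolyRing K V)) :
    coords b (∑ i ∈ s, g i • θ i) = ∑ i ∈ s, polyEquiv b (g i) • coords b (θ i) := by
  classical
  induction s using Finset.induction_on with
  | empty =>
    funext j
    simp [coords]
  | insert i s hi ih =>
    rw [Finset.sum_insert hi, Finset.sum_insert hi, ← ih]
    funext j
    simp [coords]

/-- The coordinate version tests one chosen form per hyperplane, `derivationModule` tests all of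
them. Forms with the same kernel are proportional, so the conditions agree. -/
lemma coords_mem_logDer_iff {A : HyperplaneArrangement K V}
    {θ : Derivation K (PolyRing K V) (PolyRing K V)} :
    coords b θ ∈ logDer A.hyperplanes (formCoeffs b) ↔ θ ∈ A.derivationModule := by
  have key : ∀ α : Module.Dual K V, linForm (b.equivFun α) ∣ pairing (b.equivFun α) (coords b θ) ↔
      form α ∣ θ (form α) := fun α => by
    rw [pairing_coords, ← polyEquiv_form]
    exact map_dvd_iff (polyEquiv b)
  constructor
  · intro h α hα
    obtain ⟨h0, hker⟩ := formOf_spec (A.exists_form _ hα)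
    obtain ⟨c, hc⟩ := exists_eq_smul_of_ker_le hker.le
    have h1 := (key _).1 (h _ (mem_hyperplanes.2 hα))
    have hs : form α = algebraMap K (PolyRing K V) c * form (formOf (LinearMap.ker α)) := by
      conv_lhs => rw [hc]
      rw [form, map_smul, Algebra.smul_def]
    rw [hs, Derivation.leibniz, Derivation.map_algebraMap, smul_zero, add_zero, smul_eq_mul]
    exact mul_dvd_mul_left _ h1
  · intro h H hH
    refine (key _).2 (h _ ?_)
    rw [mem_hyperplanes] at hH
    rwa [(formOf_spec (A.exists_form H hH)).2]

lemma isHomogeneousOfDegree_iff {θ : Derivation K (PolyRing K V) (PolyRing K V)} {p : ℕ} :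
    IsHomogeneousOfDegree θ p ↔ ∀ i, (coords b θ i).IsHomogeneous p := by
  refine ⟨fun h i => (isHomogeneous_polyEquiv_iff b).2 (h (b i)), fun h α => ?_⟩
  rw [← isHomogeneous_polyEquiv_iff b, ← pairing_coords, pairing_apply]
  exact IsHomogeneous.sum _ _ _ fun i _ => (h i).C_mul _

variable {b} in
lemma IsHomogeneousBasis.hasExponents {A : HyperplaneArrangement K V}
    {θ : I → I → MvPolynomial I K} {d : I → ℕ}
    (h : IsHomogeneousBasis A.hyperplanes (formCoeffs b) θ d) :
    A.HasExponents (Finset.univ.val.map d) := by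
  classical
  have hcard : Fintype.card I = Module.finrank K V := by
    have : FiniteDimensional K (Module.Dual K V) := b.finiteDimensional_of_finite
    have : FiniteDimensional K V := Module.finite_dual_iff K |>.1 this
    rw [← Subspace.dual_finrank_eq, Module.finrank_eq_card_basis b]
  let v : I → A.derivationModule := fun i =>
    ⟨ofCoords b (θ i), (coords_mem_logDer_iff b).1 (by rw [coords_ofCoords]; exact h.mem i)⟩
  have hv : ∀ g : I → PolyRing K V, coords b (∑ i, g i • v i : A.derivationModule) =
      ∑ i, polyEquiv b (g i) • θ i := fun g => by
    rw [Submodule.coe_sum]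
    simp only [Submodule.coe_smul, coords_sum_smul, v, coords_ofCoords]
  have hli : LinearIndependent (PolyRing K V) v := by
    refine Fintype.linearIndependent_iffₛ.2 fun g g' hg i => ?_
    have h1 := congrArg (fun x : A.derivationModule => coords b (x : Derivation K _ _)) hg
    simp only [hv] at h1
    rw [← sub_eq_zero, ← Finset.sum_sub_distrib] at h1
    simp only [← sub_smul] at h1
    have h2 := sum_smul_injective_of_det_ne_zero (M := Matrix.of θ)
      (h.det_ne_zero (reduced_formCoeffs b A))
      (g := fun i => polyEquiv b (g i) - polyEquiv b (g' i)) h1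
    exact (polyEquiv b).injective (sub_eq_zero.1 (congrFun h2 i))
  have hsp : ⊤ ≤ Submodule.span (PolyRing K V) (Set.range v) := by
    rintro η -
    obtain ⟨g, hg⟩ := h.span _ ((coords_mem_logDer_iff b).2 η.2)
    have : η = ∑ i, (polyEquiv b).symm (g i) • v i := by
      refine Subtype.ext (coords_injective b ?_)
      rw [hv, hg]
      simp
    rw [this]
    exact Submodule.sum_mem _ fun i _ =>
      Submodule.smul_mem _ _ (Submodule.subset_span ⟨i, rfl⟩)
  let e : I ≃ Fin (Module.finrank K V) := Fintype.equivFinOfCardEq hcard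
  refine ⟨(Module.Basis.mk hli hsp).reindex e, d ∘ e.symm, fun i => ?_, ?_⟩
  · rw [isHomogeneousOfDegree_iff b, Module.Basis.reindex_apply, Module.Basis.mk_apply]
    simp only [v, coords_ofCoords]
    exact h.isHomogeneous _
  · rw [← Multiset.map_map, Multiset.map_univ_val_equiv]

lemma HasExponents.exists_isHomogeneousBasis {A : HyperplaneArrangement K V} {m : Multiset ℕ}
    (h : A.HasExponents m) :
    ∃ (θ : I → I → MvPolynomial I K) (d : I → ℕ),
      IsHomogeneousBasis A.hyperplanes (formCoeffs b) θ d ∧ m = Finset.univ.val.map d := by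
  have hcard : Fintype.card I = Module.finrank K V := by
    have : FiniteDimensional K (Module.Dual K V) := b.finiteDimensional_of_finite
    have : FiniteDimensional K V := Module.finite_dual_iff K |>.1 this
    rw [← Subspace.dual_finrank_eq, Module.finrank_eq_card_basis b]
  obtain ⟨B, d, hd, rfl⟩ := h
  let e : I ≃ Fin (Module.finrank K V) := Fintype.equivFinOfCardEq hcard
  refine ⟨fun i => coords b (B (e i)), d ∘ e, ⟨fun i => (coords_mem_logDer_iff b).2 (B (e i)).2,
    fun i => (isHomogeneousOfDegree_iff b).1 (hd (e i)), fun η hη => ?_⟩, ?_⟩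
  · let η' : A.derivationModule :=
      ⟨ofCoords b η, (coords_mem_logDer_iff b).1 (by rwa [coords_ofCoords])⟩
    refine ⟨fun i => polyEquiv b (B.repr η' (e i)), ?_⟩
    have h1 := congrArg (fun x : A.derivationModule => coords b (x : Derivation K _ _))
      (B.sum_repr η')
    simp only [Submodule.coe_sum, Submodule.coe_smul, coords_sum_smul] at h1
    rw [coords_ofCoords, ← e.sum_comp] at h1
    exact h1.symm
  · rw [← Multiset.map_map, Multiset.map_univ_val_equiv]

end Transfer

/-! ### Adapted coordinates for a hyperplane and localization at a subspace -/

section AdaptedBasis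

variable {K : Type*} [Field K] {V : Type*} [AddCommGroup V] [Module K V]

lemma exists_basis_option {K : Type v} [Field K] {V : Type u} [AddCommGroup V] [Module K V]
    [FiniteDimensional K V] {α : Module.Dual K V} (hα : α ≠ 0) :
    ∃ (J : Type (max u v)) (_ : Fintype J) (b : Module.Basis (Option J) K (Module.Dual K V)),
      b none = α := by
  classical
  have hli : LinearIndepOn K id {α} := LinearIndepOn.singleton hα
  let b := Module.Basis.extend hli
  have : Fintype (hli.extend (Set.subset_univ _)) := FiniteDimensional.fintypeBasisIndex b
  let i₀ : hli.extend (Set.subset_univ _) := ⟨α, hli.subset_extend _ rfl⟩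
  refine ⟨{i // i ≠ i₀}, inferInstance, b.reindex (Equiv.optionSubtypeNe i₀).symm, ?_⟩
  simp [b, i₀]

variable {J : Type*} [Fintype J] {b : Module.Basis (Option J) K (Module.Dual K V)}
  {H : Submodule K V}

/-- Restriction V* → H* is surjective with kernel spanned by `b none`, so the remaining basis
vectors restrict to a basis of H*. In these coordinates restricting a form means dropping the
coordinate `none`. -/
lemma exists_restricted_basis (hb : LinearMap.ker (b none) = H) :
    ∃ b' : Module.Basis J K (Module.Dual K H), ∀ α : Module.Dual K V, ∀ j,
      b'.equivFun (α ∘ₗ H.subtype) j = b.equivFun α (some j) := by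
  have hnone : b none ∘ₗ H.subtype = 0 := by
    ext x
    have : (x : V) ∈ LinearMap.ker (b none) := hb ▸ x.2
    exact this
  have hexp : ∀ α : Module.Dual K V, α ∘ₗ H.subtype =
      ∑ j, b.equivFun α (some j) • (b (some j) ∘ₗ H.subtype) := fun α => by
    conv_lhs => rw [← b.sum_equivFun α]
    rw [Fintype.sum_option, LinearMap.add_comp, LinearMap.smul_comp, hnone, smul_zero, zero_add]
    ext x
    simp
  have hli : LinearIndependent K fun j => b (some j) ∘ₗ H.subtype := by
    rw [Fintype.linearIndependent_iff]
    intro g hg i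
    have hker : LinearMap.ker (b none) ≤ LinearMap.ker (∑ j, g j • b (some j)) := by
      rw [hb]
      intro x hx
      have := LinearMap.congr_fun hg (⟨x, hx⟩ : H)
      simpa using this
    obtain ⟨c, hc⟩ := exists_eq_smul_of_ker_le hker
    have h1 := Fintype.linearIndependent_iff.1 b.linearIndependent (fun o => o.elim (-c) g) (by
      rw [Fintype.sum_option]
      simp [hc])
    exact h1 (some i)
  have hsp : ⊤ ≤ Submodule.span K (Set.range fun j => b (some j) ∘ₗ H.subtype) := by
    rintro β -
    obtain ⟨α, rfl⟩ := LinearMap.exists_extend β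
    rw [hexp]
    exact Submodule.sum_mem _ fun j _ => Submodule.smul_mem _ _ (Submodule.subset_span ⟨j, rfl⟩)
  refine ⟨Module.Basis.mk hli hsp, fun α j => ?_⟩
  have h1 : α ∘ₗ H.subtype =
      (Module.Basis.mk hli hsp).equivFun.symm fun j => b.equivFun α (some j) := by
    rw [Module.Basis.equivFun_symm_apply, hexp]
    simp
  rw [h1, LinearEquiv.apply_symm_apply]

variable {A : HyperplaneArrangement K V}

lemma mem_carrier_restriction_iff (hH : H ∈ A.carrier) {Y : Submodule K H} :
    Y ∈ (A.restriction H).carrier ↔ ∃ H' ∈ A.hyperplanes.erase H, H'.comap H.subtype = Y := by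
  constructor
  · rintro ⟨H', ⟨hH', hle⟩, rfl⟩
    exact ⟨H', Finset.mem_erase.2 ⟨fun h => hle h.ge, mem_hyperplanes.2 hH'⟩, rfl⟩
  · rintro ⟨H', hH', rfl⟩
    rw [Finset.mem_erase, mem_hyperplanes] at hH'
    exact ⟨H', ⟨hH'.2, fun h => hH'.1 (eq_of_le hH hH'.2 h).symm⟩, rfl⟩

lemma restrictsTo_formCoeffs (hH : H ∈ A.carrier) {b' : Module.Basis J K (Module.Dual K H)}
    (hb' : ∀ α : Module.Dual K V, ∀ j,
      b'.equivFun (α ∘ₗ H.subtype) j = b.equivFun α (some j)) :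
    RestrictsTo (A.hyperplanes.erase H) (formCoeffs b) (A.restriction H).hyperplanes
      (formCoeffs b') fun H' => H'.comap H.subtype := by
  have himage : (A.hyperplanes.erase H).image (fun H' => H'.comap H.subtype) =
      (A.restriction H).hyperplanes := by
    ext Y
    rw [Finset.mem_image, mem_hyperplanes, mem_carrier_restriction_iff hH]
  refine ⟨himage, fun H' hH' => ?_⟩
  have hY : H'.comap H.subtype ∈ (A.restriction H).carrier := by
    rw [← mem_hyperplanes, ← himage]
    exact Finset.mem_image_of_mem _ hH'
  have h1 := formOf_spec (A.exists_form H' (mem_hyperplanes.1 (Finset.mem_of_mem_erase hH')))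
  obtain ⟨β, hβ0, hβ⟩ := (A.restriction H).exists_form _ hY
  have h2 := formOf_spec ⟨β, hβ0, hβ⟩
  have hker : LinearMap.ker (formOf H' ∘ₗ H.subtype) = H'.comap H.subtype := by
    rw [LinearMap.ker_comp, h1.2]
  obtain ⟨c, hc⟩ := exists_eq_smul_of_ker_le (h2.2.trans hker.symm).le
  refine ⟨c, ?_, ?_⟩
  · rintro rfl
    rw [zero_smul] at hc
    rw [hc, LinearMap.ker_zero, ← hβ] at hker
    exact hβ0 (LinearMap.ker_eq_top.1 hker.symm)
  · funext j
    rw [formCoeffs, ← hb', hc, map_smul]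
    rfl

lemma formCoeffs_eq_single [DecidableEq (Option J)] (hb : b none = formOf H) :
    formCoeffs b H = Pi.single none 1 := by
  funext o
  rw [formCoeffs, ← hb, Module.Basis.equivFun_self, Pi.single_apply]
  exact if_congr eq_comm rfl rfl

lemma hyperplanes_deletion (A : HyperplaneArrangement K V)
    (H : Submodule K V) : (A.deletion H).hyperplanes = A.hyperplanes.erase H := by
  ext H'
  rw [mem_hyperplanes, Finset.mem_erase, mem_hyperplanes]
  exact and_comm

lemma ext_carrier {A B : HyperplaneArrangement K V} (h : A.carrier = B.carrier) : A = B := by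
  cases A
  cases B
  cases h
  rfl

lemma localization_sup (A : HyperplaneArrangement K V) (U W : Submodule K V) :
    A.localization (U ⊔ W) = (A.localization U).localization W := by
  refine ext_carrier (Set.ext fun H => ?_)
  simp only [localization, Set.mem_ofPred_eq, sup_le_iff, and_assoc]

lemma hyperplanes_localization_span [DecidableEq K] {I : Type*} [Fintype I]
    (b : Module.Basis I K (Module.Dual K V)) (A : HyperplaneArrangement K V) (u : V) :
    (A.localization (K ∙ u)).hyperplanes =
      {H ∈ A.hyperplanes | formCoeffs b H ⬝ᵥ (fun i => b i u) = 0} := by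
  ext H
  rw [mem_hyperplanes, Finset.mem_filter, mem_hyperplanes]
  refine and_congr_right fun hH => ?_
  have h1 : formCoeffs b H ⬝ᵥ (fun i => b i u) = formOf H u := by
    calc formCoeffs b H ⬝ᵥ (fun i => b i u) = (∑ i, b.equivFun (formOf H) i • b i) u := by
          simp only [dotProduct, formCoeffs, LinearMap.sum_apply, LinearMap.smul_apply, smul_eq_mul]
      _ = formOf H u := by rw [b.sum_equivFun]
  rw [h1, Submodule.span_singleton_le_iff_mem]
  conv_lhs => rw [← (formOf_spec (A.exists_form H hH)).2]
  rfl

/-- `U` is finitely generated, and localizing at a sum is localizing twice; so vectors suffice. The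
arrangement varies in the induction. That `U` lies in `H` plays no role until bases are extracted.
-/
lemma hasAdaptedBasis_localization [FiniteDimensional K V] [DecidableEq J]
    (b : Module.Basis (Option J) K (Module.Dual K V))
    (H U : Submodule K V) : ∀ A : HyperplaneArrangement K V,
      HasAdaptedBasis A.hyperplanes (A.hyperplanes.erase H) (formCoeffs b) →
      HasAdaptedBasis (A.localization U).hyperplanes ((A.localization U).hyperplanes.erase H)
        (formCoeffs b) := by
  classical
  refine Submodule.fg_induction (motive := fun U _ => ∀ A : HyperplaneArrangement K V,
      HasAdaptedBasis A.hyperplanes (A.hyperplanes.erase H) (formCoeffs b) →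
      HasAdaptedBasis (A.localization U).hyperplanes ((A.localization U).hyperplanes.erase H)
        (formCoeffs b)) (fun u A hA => ?_) (fun U W _ _ hU hW A hA => ?_) U
    (IsNoetherian.noetherian U)
  · rw [hyperplanes_localization_span b A u]
    exact hA.localize (reduced_formCoeffs b A) _
  · rw [localization_sup]
    exact hW _ (hU A hA)

lemma map_some_le_map_univ (d : Option J → ℕ) :
    (Finset.univ.val.map fun j : J => d (some j)) ≤ Finset.univ.val.map d := by
  have h1 : (Finset.univ.map (Function.Embedding.some (α := J))).val ≤ Finset.univ.val :=
    Finset.val_le_iff.2 (Finset.subset_univ _)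
  have h2 := Multiset.map_le_map (f := d) h1
  rwa [Finset.map_val, Multiset.map_map] at h2

/-- The two multisets have cardinalities dim V and dim V − 1, so an inclusion leaves exactly one
surplus exponent. -/
lemma exists_eq_cons_of_le {d : Option J → ℕ} {e : J → ℕ}
    (h : Finset.univ.val.map e ≤ Finset.univ.val.map d) :
    ∃ c, Finset.univ.val.map d = c ::ₘ Finset.univ.val.map e := by
  obtain ⟨s, hs⟩ := Multiset.le_iff_exists_add.1 h
  have hcard := congrArg Multiset.card hs
  simp only [Multiset.card_map, Finset.card_val, Finset.card_univ, Fintype.card_option,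
    Multiset.card_add] at hcard
  obtain ⟨c, rfl⟩ := Multiset.card_eq_one.1 (show s.card = 1 by omega)
  exact ⟨c, by rw [hs, add_comm, Multiset.singleton_add]⟩

end AdaptedBasis

/-! ### Localization of inclusions of exponents -/

section ExponentsSubset

variable {K : Type v} [Field K] {V : Type u} [AddCommGroup V] [Module K V]

/-- Inclusions of exponents localize. -/
lemma ExponentsSubset.localization [FiniteDimensional K V] {A : HyperplaneArrangement K V}
    {H : Submodule K V} (hH : H ∈ A.carrier)
    (hexp : ExponentsSubset (A.restriction H) (A.deletion H) ∨ ExponentsSubset (A.restriction H) A)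
    {U : Submodule K V} (hU : U ≤ H) :
    ExponentsSubset ((A.localization U).restriction H) ((A.localization U).deletion H) ∧
      ExponentsSubset ((A.localization U).restriction H) (A.localization U) := by
  classical
  obtain ⟨hne, hker⟩ := formOf_spec (A.exists_form H hH)
  obtain ⟨J, _, b, hb⟩ := exists_basis_option hne
  obtain ⟨b', hb'⟩ := exists_restricted_basis (b := b) (H := H) (by rw [hb, hker])
  have ha : formCoeffs b H = Pi.single none 1 := formCoeffs_eq_single hb
  have hA : HasAdaptedBasis A.hyperplanes (A.hyperplanes.erase H) (formCoeffs b) := by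
    rcases hexp with ⟨e, f, he, hf, hef⟩ | ⟨e, f, he, hf, hef⟩
    · obtain ⟨θ'', e, he'', rfl⟩ := he.exists_isHomogeneousBasis b'
      obtain ⟨θ, d, hd, rfl⟩ := hf.exists_isHomogeneousBasis b
      obtain ⟨c, hc⟩ := exists_eq_cons_of_le hef
      rw [hyperplanes_deletion] at hd
      exact (restrictsTo_formCoeffs hH hb').hasAdaptedBasis_of_deletion (reduced_formCoeffs b A)
        (reduced_formCoeffs b' _) (mem_hyperplanes.2 hH) ha hd he'' hc
    · obtain ⟨θ'', e, he'', rfl⟩ := he.exists_isHomogeneousBasis b'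
      obtain ⟨θ, d, hd, rfl⟩ := hf.exists_isHomogeneousBasis b
      obtain ⟨c, hc⟩ := exists_eq_cons_of_le hef
      exact (restrictsTo_formCoeffs hH hb').hasAdaptedBasis_of_addition (reduced_formCoeffs b A)
        (reduced_formCoeffs b' _) (mem_hyperplanes.2 hH) ha hd he'' hc
  have hHU : H ∈ (A.localization U).carrier := ⟨hH, hU⟩
  obtain ⟨d, θ', θ, θ'', h', h, h''⟩ :=
    (hasAdaptedBasis_localization b H U A hA).exists_isHomogeneousBasis
      (restrictsTo_formCoeffs hHU hb') (reduced_formCoeffs b _) (reduced_formCoeffs b' _)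
      (mem_hyperplanes.2 hHU) ha
  rw [← hyperplanes_deletion] at h'
  refine ⟨⟨_, _, h''.hasExponents, h'.hasExponents, map_some_le_map_univ d⟩,
    ⟨_, _, h''.hasExponents, h.hasExponents, ?_⟩⟩
  -- Passing from the deletion to the arrangement raises only the exponent at `none`, so the
  -- exponents of the restriction remain included.
  simpa using map_some_le_map_univ (Function.update d none (d none + 1))

end ExponentsSubset

/-! ### Localization of the three classes -/

section Localization

variable {K : Type v} [Field K] {V : Type u} [AddCommGroup V] [Module K V]

lemma localization_empty (U : Submodule K V) :
    (empty K V).localization U = empty K V :=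
  ext_carrier (Set.ext fun _ => ⟨fun h => h.1, fun h => absurd h (Set.notMem_empty _)⟩)

lemma localization_deletion (A : HyperplaneArrangement K V) (H U : Submodule K V) :
    (A.deletion H).localization U = (A.localization U).deletion H := by
  refine ext_carrier (Set.ext fun H' => ?_)
  simp only [localization, deletion, Set.mem_ofPred_eq, Set.mem_sdiff]
  tauto

lemma localization_deletion_of_not_le (A : HyperplaneArrangement K V) {H U : Submodule K V}
    (hU : ¬ U ≤ H) : (A.deletion H).localization U = A.localization U := by
  refine ext_carrier (Set.ext fun H' => ?_)
  simp only [localization, deletion, Set.mem_ofPred_eq, Set.mem_sdiff, Set.mem_singleton_iff]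
  refine ⟨fun h => ⟨h.1.1, h.2⟩, fun h => ⟨⟨h.1, ?_⟩, h.2⟩⟩
  rintro rfl
  exact hU h.2

lemma localization_restriction (A : HyperplaneArrangement K V) {X U : Submodule K V} (hU : U ≤ X) :
    (A.restriction X).localization (U.comap X.subtype) = (A.localization U).restriction X := by
  have key : ∀ H : Submodule K V, U.comap X.subtype ≤ H.comap X.subtype ↔ U ≤ H := fun H =>
    ⟨fun h x hx => h (show (⟨x, hU hx⟩ : X) ∈ U.comap X.subtype from hx),
      fun h => Submodule.comap_mono h⟩
  refine ext_carrier (Set.ext fun Y => ?_)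
  constructor
  · rintro ⟨⟨H, ⟨hH, hX⟩, rfl⟩, hY⟩
    exact ⟨H, ⟨⟨hH, (key H).1 hY⟩, hX⟩, rfl⟩
  · rintro ⟨H, ⟨⟨hH, hHU⟩, hX⟩, rfl⟩
    exact ⟨⟨H, ⟨hH, hX⟩, rfl⟩, (key H).2 hHU⟩

/-- Finite-dimensionality is part of the induction: only the constructor `empty` assumes it, and it
passes upwards from the deletion, which lives in the same space. -/
theorem IsInductivelyFree.localization {A : HyperplaneArrangement K V} (hA : A.IsInductivelyFree) :
    FiniteDimensional K V ∧ ∀ U : Submodule K V, (A.localization U).IsInductivelyFree := by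
  induction hA with
  | empty V =>
    refine ⟨inferInstance, fun U => ?_⟩
    rw [localization_empty]
    exact .empty V
  | addition A H hH h' h'' hexp ih' ih'' =>
    have := ih'.1
    refine ⟨this, fun U => ?_⟩
    -- If `H` does not contain `U`, it disappears from the localization, and the deletion already
    -- gives the claim.
    by_cases hU : U ≤ H
    · refine .addition _ H ⟨hH, hU⟩ ?_ ?_ (ExponentsSubset.localization hH (.inl hexp) hU).1
      · rw [← localization_deletion]
        exact ih'.2 U
      · rw [← localization_restriction A hU]
        exact ih''.2 _
    · rw [← localization_deletion_of_not_le A hU]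
      exact ih'.2 U

theorem IsRecursivelyFree.localization {A : HyperplaneArrangement K V} (hA : A.IsRecursivelyFree) :
    FiniteDimensional K V ∧ ∀ U : Submodule K V, (A.localization U).IsRecursivelyFree := by
  induction hA with
  | empty V =>
    refine ⟨inferInstance, fun U => ?_⟩
    rw [localization_empty]
    exact .empty V
  | addition A H hH h' h'' hexp ih' ih'' =>
    have := ih'.1
    refine ⟨this, fun U => ?_⟩
    by_cases hU : U ≤ H
    · refine .addition _ H ⟨hH, hU⟩ ?_ ?_ (ExponentsSubset.localization hH (.inl hexp) hU).1
      · rw [← localization_deletion]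
        exact ih'.2 U
      · rw [← localization_restriction A hU]
        exact ih''.2 _
    · rw [← localization_deletion_of_not_le A hU]
      exact ih'.2 U
  | deletion A H hH h h'' hexp ih ih'' =>
    have := ih.1
    refine ⟨this, fun U => ?_⟩
    by_cases hU : U ≤ H
    · rw [localization_deletion]
      refine .deletion _ H ⟨hH, hU⟩ (ih.2 U) ?_
        (ExponentsSubset.localization hH (.inr hexp) hU).2
      rw [← localization_restriction A hU]
      exact ih''.2 _
    · rw [localization_deletion_of_not_le A hU]
      exact ih.2 U

/-- An intersection X of hyperplanes of the localization contains U and also lies in the lattice of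
A. Hence the restriction of the localization to X is a localization of A^X, which is inductively
free. -/
theorem IsHereditarilyInductivelyFree.localization {A : HyperplaneArrangement K V}
    (hA : A.IsHereditarilyInductivelyFree) (U : Submodule K V) :
    (A.localization U).IsHereditarilyInductivelyFree := by
  rintro X ⟨B, hB, rfl⟩
  have hU : U ≤ sInf B := le_sInf fun H hH => (hB hH).2
  rw [← localization_restriction A hU]
  exact (hA _ ⟨B, fun H hH => (hB hH).1, rfl⟩).localization.2 _

end Localization

end HyperplaneArrangement

theorem theorem1p1 {K : Type v} [Field K] {V : Type u} [AddCommGroup V] [Module K V]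
    [FiniteDimensional K V] (A : HyperplaneArrangement K V) (U : Submodule K V) :
    (A.IsInductivelyFree → (A.localization U).IsInductivelyFree) ∧
    (A.IsRecursivelyFree → (A.localization U).IsRecursivelyFree) ∧
    (A.IsHereditarilyInductivelyFree → (A.localization U).IsHereditarilyInductivelyFree) :=
  ⟨fun h => h.localization.2 U, fun h => h.localization.2 U, fun h => h.localization U⟩
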